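/- **Setting.** All algebras are associative and not necessarily unital. Let $F$ be a field, $n,m\in\mathbb N$, and let $P=(p_{ji})$ be an $m\times n$ matrix with entries in $\{e\}^0=\{e,\theta\}$. Let $S=\mathcal M(\{e\}^0;n,m;P)$ be the Rees matrix semigroup consisting of the zero $\theta$ and the $nm$ elements $(e,i,j)$, with $(e,i,j)(e,k,\ell)=(e,i,\ell)$ if $p_{jk}=e$ and $=\theta$ if $p_{jk}=\theta$. Let $A=\bigoplus_{s\in S}A^{(s)}$ be a finite dimensional $S$-graded $F$-algebra with $A^{(\theta)}=0$ which is $S$-graded-simple, i.e. $A^2\ne0$ and $0$, $A$ are the only homogeneous two-sided ideals of $A$. Write $A_{ij}=A^{(e,i,j)}$, $L_j=\bigoplus_k A_{kj}$, $R_i=\bigoplus_k A_{ik}$, and let $J(A)$ be the Jacobson radical. For $r\in A$ write $x(1-r)=x-xr$ and $(1-r)x=x-rx$. All direct sums are direct sums of subspaces. **Theorem.** (a) There exist a subalgebra $B\subseteq A$, orthogonal idempotents $f_1,\dots,f_m$ and orthogonal idempotents $f'_1,\dots,f'_n$ (some may be zero), with $f_j\in B\cap L_j$, $f'_i\in B\cap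 R_i$, such that $B=\bigoplus_{i,j}f'_iAf_j=\bigoplus_{i,j}(B\cap A_{ij})$ is a maximal semisimple subalgebra of $A$, $\sum_if'_i=\sum_jf_j=1_B$ is the identity of $B$, and $A=B\oplus J(A)$. (b) Let $B,f_j,f'_i$ be any data as in (a), and put $J^{10}_{ij}=f'_iL_j(1-1_B)$, $J^{01}_{ij}=(1-1_B)R_if_j$, $J^{10}_{*j}=\sum_iJ^{10}_{ij}$, $J^{01}_{i*}=\sum_jJ^{01}_{ij}$. Then: 1. $J^{10}_{*j}=1_BL_j(1-1_B)$ is a left $B$-submodule of $J(A)$ and $J^{10}_{*j}=\bigoplus_iJ^{10}_{ij}$; $J^{01}_{i*}=(1-1_B)R_i1_B$ is a right $B$-submodule of $J(A)$ and $J^{01}_{i*}=\bigoplus_jJ^{01}_{ij}$. 2. $J(A)=\bigoplus_{i}J^{01}_{i*}\oplus\bigoplus_{j}J^{10}_{*j}\oplus J(A)^2$ and $J(A)^2=\bigoplus_{i,j}J^{01}_{i*}J^{10}_{*j}$. 3. There is a unique $F$-linear map $\varphi\colon\bigoplus_iJ^{01}_{i*}\oplus\bigoplus_jJ^{10}_{*j}\to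 B$ such that $\varphi(a-1_Ba1_B)=1_Ba1_B-f'_iaf_j$ for all $i,j$ and all $a\in f'_iA_{ij}+A_{ij}f_j$. Its restriction to $\bigoplus_jJ^{10}_{*j}$ is a homomorphism of left $B$-modules, its restriction to $\bigoplus_iJ^{01}_{i*}$ is a homomorphism of right $B$-modules, and for all $i,j$ $$J^{10}_{*j}\cap\ker\varphi=0,\quad \varphi(J^{10}_{*j})\cap Bf_j=\varphi(J^{10}_{*j})f_j=0,\qquad J^{01}_{i*}\cap\ker\varphi=0,\quad \varphi(J^{01}_{i*})\cap f'_iB=f'_i\varphi(J^{01}_{i*})=0.$$ 4. For all $i,j$, $$A_{ij}=f'_iBf_j\oplus\{\varphi(v)+v\mid v\in J^{10}_{ij}\oplus J^{01}_{ij}\}\oplus\langle\varphi(v)\varphi(w)+v\varphi(w)+\varphi(v)w+vw\mid v\in J^{01}_{i*},\,w\in J^{10}_{*j}\rangle_F .$$ 5. For all $i,j$ and all finite families $v_\ell\in J^{01}_{i*}$, $w_\ell\in J^{10}_{*j}$: $\sum_\ell v_\ell w_\ell=0$ if and only if $\sum_\ell\varphi(v_\ell)\varphi(w_\ell)=0$.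 6. $B\cong M_k(D)$ as $F$-algebras for some $k\in\mathbb N$ and some finite dimensional division $F$-algebra $D$; so $\dim_FB=k^2\dim_FD$. 7. $\dim_F\bigoplus_iJ^{01}_{i*}\le(n-1)\dim_FB$, $\ \dim_F\bigoplus_jJ^{10}_{*j}\le(m-1)\dim_FB$, and $\dim_FJ(A)\le(nm-1)\dim_FB$, where $nm=|S\setminus\{\theta\}|=|S|-1$. -/

import Mathlib

universe u v

/-- The Rees `I × J` matrix semigroup `M(G⁰; I, J; P)` over a group with zero `G⁰`: its elements are
the triples `(g, i, j)` with `g ∈ G`, `i ∈ I`, `j ∈ J`, together with a zero element `θ`. The sandwich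
matrix `P` is a `J × I` matrix with entries in `G⁰`. -/
inductive ReesMatrixSemigroup {G I J : Type*} (P : J → I → WithZero G) : Type _
  | zero : ReesMatrixSemigroup P
  | elt (g : G) (i : I) (j : J) : ReesMatrixSemigroup P

namespace ReesMatrixSemigroup

variable {G I J : Type*} {P : J → I → WithZero G}

instance : Zero (ReesMatrixSemigroup P) := ⟨zero⟩

/-- The triple `(x, i, j)` with `x ∈ G⁰`, where `(0, i, j)` is identified with the zero element. -/
def triple (x : WithZero G) (i : I) (j : J) : ReesMatrixSemigroup P :=
  match x with
  | none => zero
  | some g => elt g i j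

/-- `(g, i, j) (h, k, l) = (g p_{jk} h, i, l)`. -/
instance [Group G] : Mul (ReesMatrixSemigroup P) where
  mul
    | zero, _ => zero
    | elt _ _ _, zero => zero
    | elt g i j, elt h k l => triple ((g : WithZero G) * P j k * (h : WithZero G)) i l

theorem zero_def : (0 : ReesMatrixSemigroup P) = zero := rfl

theorem elt_mul_elt [Group G] (g h : G) (i k : I) (j l : J) :
    (elt g i j : ReesMatrixSemigroup P) * elt h k l
      = triple ((g : WithZero G) * P j k * (h : WithZero G)) i l := rfl

theorem triple_zero (i : I) (j : J) : (triple 0 i j : ReesMatrixSemigroup P) = 0 := rfl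

theorem triple_coe (g : G) (i : I) (j : J) :
    (triple (g : WithZero G) i j : ReesMatrixSemigroup P) = elt g i j := rfl

theorem triple_mul_triple [Group G] (x y : WithZero G) (i k : I) (j l : J) :
    (triple x i j : ReesMatrixSemigroup P) * triple y k l = triple (x * P j k * y) i l := by
  induction x using WithZero.recZeroCoe with
  | zero => simp only [zero_mul]; rfl
  | coe g =>
    induction y using WithZero.recZeroCoe with
    | zero => simp only [mul_zero]; rfl
    | coe h => rfl

instance [Group G] : SemigroupWithZero (ReesMatrixSemigroup P) where
  zero_mul _ := rfl
  mul_zero a := by cases a <;> rfl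
  mul_assoc a b c := by
    have key : ∀ a : ReesMatrixSemigroup P, a = 0 ∨ ∃ x i j, a = triple x i j := by
      intro a
      cases a with
      | zero => exact Or.inl rfl
      | elt g i j => exact Or.inr ⟨(g : WithZero G), i, j, rfl⟩
    have z1 : ∀ a : ReesMatrixSemigroup P, 0 * a = 0 := fun _ => rfl
    have z2 : ∀ a : ReesMatrixSemigroup P, a * 0 = 0 := fun a => by cases a <;> rfl
    rcases key a with rfl | ⟨x, i, j, rfl⟩
    · simp only [z1]
    rcases key b with rfl | ⟨y, k, l, rfl⟩
    · simp only [z1, z2]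
    rcases key c with rfl | ⟨z, p, q, rfl⟩
    · simp only [z2]
    simp only [triple_mul_triple, mul_assoc]

end ReesMatrixSemigroup

section Algebra

variable {F : Type v} [Field F] {A : Type u} [NonUnitalRing A] [Module F A]

/-- `N` is the (internal) direct sum of the family of subspaces `M`. -/
def IsDirectSum {ι : Type*} (M : ι → Submodule F A) (N : Submodule F A) : Prop :=
  iSupIndep M ∧ ⨆ i, M i = N

/-- `A = ⨁_{s ∈ S} A^{(s)}` is a grading by the semigroup `S`. -/
structure IsSemigroupGrading {S : Type*} [Mul S] (𝒜 : S → Submodule F A) : Prop where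
  isDirectSum : IsDirectSum 𝒜 ⊤
  mul_mem : ∀ (s t : S) (x y : A), x ∈ 𝒜 s → y ∈ 𝒜 t → x * y ∈ 𝒜 (s * t)

/-- The subspace `I` is a two-sided ideal of the algebra `A`. -/
def IsTwoSidedAlgIdeal (I : Submodule F A) : Prop :=
  ∀ (a x : A), x ∈ I → a * x ∈ I ∧ x * a ∈ I

/-- The subspace `M` is homogeneous: `M = ⨁_{s} (A^{(s)} ∩ M)`. -/
def IsHomogeneousSubspace {S : Type*} (𝒜 : S → Submodule F A) (M : Submodule F A) : Prop :=
  IsDirectSum (fun s => 𝒜 s ⊓ M) M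

/-- `A² ≠ 0`, and `0` and `A` are the only homogeneous two-sided ideals of `A`. -/
structure IsGradedSimple {S : Type*} (𝒜 : S → Submodule F A) : Prop where
  mul_ne_zero : ∃ x y : A, x * y ≠ 0
  eq_bot_or_eq_top : ∀ I : Submodule F A,
    IsTwoSidedAlgIdeal I → IsHomogeneousSubspace 𝒜 I → I = ⊥ ∨ I = ⊤

variable [IsScalarTower F A A] [SMulCommClass F A A]

/-- If `xa` and `xb` are quasi-regular for all `x`, then so is `x(a + b)`. -/
theorem isQuasiregular_mul_add {R : Type*} [NonUnitalRing R] {a b : R}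
    (ha : ∀ x, IsQuasiregular (x * a)) (hb : ∀ x, IsQuasiregular (x * b)) (x : R) :
    IsQuasiregular (x * (a + b)) := by
  obtain ⟨y, hy1, hy2⟩ := isQuasiregular_iff.1 (ha x)
  -- `1 + xa + xb = (1 + xa)(1 + (1 + y)xb)`
  have h1 := isQuasiregular_iff'.1 (ha x)
  have h2 := isQuasiregular_iff'.1 (hb (x + y * x))
  rw [isQuasiregular_iff']
  have h3 : PreQuasiregular.equiv (x * (a + b))
      = PreQuasiregular.equiv (x * a) * PreQuasiregular.equiv ((x + y * x) * b) := by
    apply PreQuasiregular.equiv.symm.injective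
    change x * (a + b) = (x + y * x) * b + x * a + x * a * ((x + y * x) * b)
    have hz : (y + x * a + x * a * y) * (x * b) = 0 := by
      rw [hy1, zero_mul]
    have : (x + y * x) * b + x * a + x * a * ((x + y * x) * b)
        = x * (a + b) + (y + x * a + x * a * y) * (x * b) := by noncomm_ring
    rw [this, hz, add_zero]
  rw [h3]
  exact h1.mul h2

variable (F A) in
/-- The Jacobson radical `J(A)` of a not necessarily unital algebra: the set of all `a` such that
`x a` is quasi-regular for every `x ∈ A`. -/
def jacobsonRadical : Submodule F A where
  carrier := {a | ∀ x : A, IsQuasiregular (x * a)}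
  zero_mem' := fun x => by
    rw [mul_zero]
    exact isQuasiregular_iff.2 ⟨0, by simp, by simp⟩
  add_mem' := fun ha hb x => isQuasiregular_mul_add ha hb x
  smul_mem' := fun c a ha x => by
    have h := ha (c • x)
    rwa [smul_mul_assoc, ← mul_smul_comm] at h

/-- The product `M N` of two subspaces, spanned by all products `x y` with `x ∈ M`, `y ∈ N`. -/
def subspaceMul (M N : Submodule F A) : Submodule F A :=
  Submodule.span F {z | ∃ x ∈ M, ∃ y ∈ N, z = x * y}

variable (F) in
/-- The map `x ↦ x (1 - e) = x - x e`. -/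
def mulOneSub (e : A) : A →ₗ[F] A := LinearMap.id - LinearMap.mulRight F e

variable (F) in
/-- The map `x ↦ (1 - e) x = x - e x`. -/
def oneSubMul (e : A) : A →ₗ[F] A := LinearMap.id - LinearMap.mulLeft F e

variable (F) in
/-- The map `x ↦ a x b`. -/
def sandwichMul (a b : A) : A →ₗ[F] A := LinearMap.mulRight F b ∘ₗ LinearMap.mulLeft F a

section Rees

variable {n m : ℕ} {P : Fin m → Fin n → WithZero Unit}
  (𝒜 : ReesMatrixSemigroup P → Submodule F A)

/-- The homogeneous component `A_{ij}` of degree `(e, i, j)`. -/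
def homComp (i : Fin n) (j : Fin m) : Submodule F A := 𝒜 (.elt 1 i j)

/-- The left ideal `L_j = ⨁_k A_{kj}`. -/
def colIdeal (j : Fin m) : Submodule F A := ⨆ k : Fin n, homComp 𝒜 k j

/-- The right ideal `R_i = ⨁_k A_{ik}`. -/
def rowIdeal (i : Fin n) : Submodule F A := ⨆ k : Fin m, homComp 𝒜 i k

/-- `B` is a semisimple subalgebra that is maximal among the semisimple subalgebras. (A finite
dimensional algebra is semisimple when its Jacobson radical is zero.) -/
def IsMaximalSemisimple (B : NonUnitalSubalgebra F A) : Prop :=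
  Maximal (fun C : NonUnitalSubalgebra F A => jacobsonRadical F C = ⊥) B

/-- A graded Wedderburn-Malcev decomposition `A = B ⊕ J(A)` given by orthogonal idempotents
`f'_1, …, f'_n` and `f_1, …, f_m` (some of them may be zero). -/
structure IsGradedWedderburnMalcev (B : NonUnitalSubalgebra F A) (f' : Fin n → A) (f : Fin m → A) :
    Prop where
  idem_row : ∀ i, f' i * f' i = f' i
  orth_row : ∀ i k, i ≠ k → f' i * f' k = 0
  idem_col : ∀ j, f j * f j = f j
  orth_col : ∀ j k, j ≠ k → f j * f k = 0
  row_mem : ∀ i, f' i ∈ B ∧ f' i ∈ rowIdeal 𝒜 i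
  col_mem : ∀ j, f j ∈ B ∧ f j ∈ colIdeal 𝒜 j
  sum_eq : ∑ i, f' i = ∑ j, f j
  isOne : ∀ b ∈ B, (∑ j, f j) * b = b ∧ b * (∑ j, f j) = b
  peirce : IsDirectSum
    (fun p : Fin n × Fin m => (⊤ : Submodule F A).map (sandwichMul F (f' p.1) (f p.2)))
    B.toSubmodule
  graded : IsDirectSum (fun p : Fin n × Fin m => B.toSubmodule ⊓ homComp 𝒜 p.1 p.2) B.toSubmodule
  maximal : IsMaximalSemisimple B
  isCompl : IsCompl B.toSubmodule (jacobsonRadical F A)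

variable (f' : Fin n → A) (f : Fin m → A)

/-- `J¹⁰_{ij} = f'_i L_j (1 - 1_B)`, where `1_B = ∑_j f_j`. -/
def J10 (i : Fin n) (j : Fin m) : Submodule F A :=
  (colIdeal 𝒜 j).map (mulOneSub F (∑ l, f l) ∘ₗ LinearMap.mulLeft F (f' i))

/-- `J⁰¹_{ij} = (1 - 1_B) R_i f_j`, where `1_B = ∑_j f_j`. -/
def J01 (i : Fin n) (j : Fin m) : Submodule F A :=
  (rowIdeal 𝒜 i).map (oneSubMul F (∑ l, f l) ∘ₗ LinearMap.mulRight F (f j))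

/-- `J¹⁰_{*j} = ∑_i J¹⁰_{ij}`. -/
def J10col (j : Fin m) : Submodule F A := ⨆ i, J10 𝒜 f' f i j

/-- `J⁰¹_{i*} = ∑_j J⁰¹_{ij}`. -/
def J01row (i : Fin n) : Submodule F A := ⨆ j, J01 𝒜 f i j

/-- The domain `⨁_i J⁰¹_{i*} ⊕ ⨁_j J¹⁰_{*j}` of the map `φ`. -/
def phiDomain : Submodule F A := (⨆ i, J01row 𝒜 f i) ⊔ (⨆ j, J10col 𝒜 f' f j)

variable {𝒜 f' f} {B : NonUnitalSubalgebra F A}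

/-- The defining formula `φ(a - 1_B a 1_B) = 1_B a 1_B - f'_i a f_j` for
`a ∈ f'_i A_{ij} + A_{ij} f_j`, where `1_B = ∑_j f_j`. -/
def IsPhi (φ : phiDomain 𝒜 f' f →ₗ[F] B) : Prop :=
  ∀ (i : Fin n) (j : Fin m) (a : A),
    a ∈ (homComp 𝒜 i j).map (LinearMap.mulLeft F (f' i)) ⊔
        (homComp 𝒜 i j).map (LinearMap.mulRight F (f j)) →
    ∃ h : a - (∑ l, f l) * a * (∑ l, f l) ∈ phiDomain 𝒜 f' f,
      ((φ ⟨a - (∑ l, f l) * a * (∑ l, f l), h⟩ : B) : A)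
        = (∑ l, f l) * a * (∑ l, f l) - f' i * a * f j

/-- The image `φ(M) ⊆ B ⊆ A` of a subspace `M` of the domain of `φ`. -/
def phiImage (φ : phiDomain 𝒜 f' f →ₗ[F] B) (M : Submodule F A) : Submodule F A :=
  ((M.comap (phiDomain 𝒜 f' f).subtype).map φ).map B.toSubmodule.subtype

/-- The subspace `{φ(v) + v ∣ v ∈ M}` for a subspace `M` of the domain of `φ`. -/
def phiGraph (φ : phiDomain 𝒜 f' f →ₗ[F] B) (M : Submodule F A) : Submodule F A :=
  (M.comap (phiDomain 𝒜 f' f).subtype).map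
    (B.toSubmodule.subtype ∘ₗ φ + (phiDomain 𝒜 f' f).subtype)

/-- `⟨φ(v)φ(w) + vφ(w) + φ(v)w + vw ∣ v ∈ J⁰¹_{i*}, w ∈ J¹⁰_{*j}⟩_F`. -/
def phiSpan (φ : phiDomain 𝒜 f' f →ₗ[F] B) (i : Fin n) (j : Fin m) : Submodule F A :=
  Submodule.span F {x | ∃ v w : phiDomain 𝒜 f' f,
    (v : A) ∈ J01row 𝒜 f i ∧ (w : A) ∈ J10col 𝒜 f' f j ∧
    x = (φ v : A) * (φ w : A) + (v : A) * (φ w : A) + (φ v : A) * (w : A) + (v : A) * (w : A)}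

end Rees

end Algebra

/-! The sandwich matrix matters only through A_ij A_kl ⊆ A_il. Thus A is a direct sum of the right
ideals R_i and of the left ideals L_j, with commuting projections such that pr_i(xy) = pr_i(x)y and
pc_j(xy) = x pc_j(y) (`RectGrading`). For any two-sided ideal I, homogeneous or not, the span of AIA
is therefore homogeneous, hence 0 or A (`span_eq_bot_or_eq_top`). It follows that J(A) = {a | AaA =
0} (`mem_jacobsonRadical_iff`), while an element all of whose homogeneous components lie in J(A) is
zero (`eq_zero_of_components`). Everything rests on these two facts.

Semisimplicity of the unitization modulo its radical gives an identity of A modulo J(A). Since AJA =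
0, its cube is an honest idempotent e. The map a ↦ eae is a multiplicative retraction onto B = eAe
with kernel J(A), and B is simple, so Wedderburn's theorem applies. The images eL_je span the
semisimple ring B and so contain orthogonal idempotents with sum 1; these, and their row analogues,
lift to homogeneous f_j and f'_i. A symmetric choice of lifts gives both families the same sum
(`exists_rectIdempotents`). Conversely, any data as in (a) have B = eAe for e = ∑ f_j, so part (b)
only concerns such idempotents.

The Peirce decomposition for e gives ⨁ J⁰¹_{i*} = (1-e)Ae, ⨁ J¹⁰_{*j} = eA(1-e) and J(A)² =
(1-e)A(1-e). The grading enters through pr_i(ex) = f'_i x and pc_j(xe) = xf_j. Each v in J¹⁰_{*j} is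
x - xe with x in eL_j, and φ(v) = xe - xf_j is exactly what makes φ(v) + v = x(1-f_j) an element of
L_j; the row case is symmetric. Hence the decomposition of A_ij is its Peirce decomposition for f'_i
on the left and f_j on the right (`isDirectSum_homComp`), and injectivity of φ and the equivalence
of linear relations follow because J(A) has no nonzero homogeneous elements.

For the dimensions, the maps u ↦ (e pr_i(u))_i on Ae, u ↦ (pc_j(u)e)_j on eA and a ↦ (e a_ij e)_{ij}
on A are injective into powers of B. -/

/-! ### The Jacobson radical of a non-unital algebra -/

section NonUnitalRadical

/-- `1 + ab` is invertible as soon as `1 + ba` is. -/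
theorem isQuasiregular_mul_swap {R : Type*} [NonUnitalRing R] {a b : R}
    (h : IsQuasiregular (b * a)) : IsQuasiregular (a * b) := by
  obtain ⟨y, h1, h2⟩ := isQuasiregular_iff.1 h
  -- From (1 + ab)⁻¹ = 1 - a(1 + ba)⁻¹b with (1 + ba)⁻¹ = 1 + y.
  refine isQuasiregular_iff.2 ⟨-(a * b) - a * y * b, ?_, ?_⟩
  · have : -(a * b) - a * y * b + a * b + a * b * (-(a * b) - a * y * b)
        = -(a * (y + b * a + b * a * y) * b) := by noncomm_ring
    rw [this, h1]; simp
  · have : a * b + (-(a * b) - a * y * b) + (-(a * b) - a * y * b) * (a * b)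
        = -(a * (b * a + y + y * (b * a)) * b) := by noncomm_ring
    rw [this, h2]; simp

/-- A square-zero element is quasi-regular. -/
theorem isQuasiregular_of_sq_zero {R : Type*} [NonUnitalRing R] {a : R} (h : a * a = 0) :
    IsQuasiregular a :=
  isQuasiregular_iff.2 ⟨-a, by simp [h], by simp [h]⟩

variable {F : Type v} [Field F] {A : Type u} [NonUnitalRing A] [Module F A]
variable [IsScalarTower F A A] [SMulCommClass F A A]

theorem jacobsonRadical_isTwoSided : IsTwoSidedAlgIdeal (jacobsonRadical F A) := by
  intro b a ha
  refine ⟨fun x => ?_, fun x => ?_⟩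
  · rw [← mul_assoc]; exact ha _
  · rw [← mul_assoc]
    exact isQuasiregular_mul_swap (by rw [← mul_assoc]; exact ha _)

/-- The Jacobson radical has no nonzero idempotents. -/
theorem eq_zero_of_idem_mem_jacobsonRadical {e : A} (he : e * e = e)
    (h : e ∈ jacobsonRadical F A) : e = 0 := by
  -- The multiplier -e makes the quasi-regular element equal to -e, formally 1 - e; multiplying y -
  -- e - ey = 0 by e leaves -e = 0.
  obtain ⟨y, h1, -⟩ := isQuasiregular_iff.1 (h (-e))
  have h3 := congrArg (fun z => e * z) h1
  have h4 : e * (e * y) = e * y := by rw [← mul_assoc, he]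
  simp only [mul_add, neg_mul, mul_neg, he, h4, mul_zero] at h3
  simpa using h3

end NonUnitalRadical

/-! ### Criteria for independence of subspaces -/

section Independence

variable {F : Type v} [Ring F] {A : Type u} [AddCommGroup A] [Module F A]

/-- A finite family of subspaces is independent if only the zero family of vectors sums to zero. -/
theorem iSupIndep_of_sum_eq_zero {ι : Type*} [Fintype ι] (M : ι → Submodule F A)
    (h : ∀ x : ι → A, (∀ i, x i ∈ M i) → ∑ i, x i = 0 → ∀ i, x i = 0) : iSupIndep M := by
  classical
  rw [iSupIndep_iff_dfinsupp_lsum_injective, injective_iff_map_eq_zero]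
  intro x hx
  ext i
  refine h (fun i => x i) (fun i => (x i).2) ?_ i
  rw [← hx, DFinsupp.lsum_apply_apply, DFinsupp.sumAddHom_apply, DFinsupp.sum_eq_sum_fintype]
  · rfl
  · intro i; simp

theorem iSupIndep.sum_eq_zero {ι : Type*} [Fintype ι] {M : ι → Submodule F A}
    (h : iSupIndep M) (x : ι → A) (hx : ∀ i, x i ∈ M i) (h0 : ∑ i, x i = 0) (i : ι) :
    x i = 0 := by
  classical
  have := iSupIndep_def.1 h i
  rw [Submodule.disjoint_def] at this
  refine this _ (hx i) ?_
  have h1 : x i = -∑ k ∈ Finset.univ.erase i, x k := by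
    rw [← Finset.add_sum_erase _ _ (Finset.mem_univ i)] at h0
    exact eq_neg_of_add_eq_zero_left h0
  rw [h1]
  refine Submodule.neg_mem _ (Submodule.sum_mem _ fun k hk => ?_)
  exact Submodule.mem_iSup_of_mem k (Submodule.mem_iSup_of_mem (Finset.ne_of_mem_erase hk) (hx k))

/-- Linear maps that restrict to the identity on one member and to zero on the others witness
independence. -/
theorem iSupIndep_of_projections {ι : Type*} [Fintype ι] (M : ι → Submodule F A)
    (p : ι → A →ₗ[F] A) (h1 : ∀ i, ∀ x ∈ M i, p i x = x)
    (h2 : ∀ i k, k ≠ i → ∀ x ∈ M k, p i x = 0) : iSupIndep M := by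
  refine iSupIndep_of_sum_eq_zero M fun x hx h0 i => ?_
  have := congrArg (p i) h0
  rw [map_sum, map_zero, Finset.sum_eq_single i, h1 i _ (hx i)] at this
  · exact this
  · intro k _ hk; exact h2 i k hk _ (hx k)
  · simp

end Independence

/-! ### Algebras with compatible row and column projections -/

section RectGrading

/-- A decomposition of an algebra into right ideals and, compatibly, into left ideals, given by the
projections `pr i` and `pc j`. The components `A_{ij}` are the common images of `pr i` and `pc j`. -/
structure RectGrading (F : Type v) [Field F] (A : Type u) [NonUnitalRing A] [Module F A]
    (n m : ℕ) where
  pr : Fin n → A →ₗ[F] A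
  pc : Fin m → A →ₗ[F] A
  pr_mul : ∀ i x y, pr i (x * y) = pr i x * y
  pc_mul : ∀ j x y, pc j (x * y) = x * pc j y
  sum_pr : ∀ x, ∑ i, pr i x = x
  sum_pc : ∀ x, ∑ j, pc j x = x
  pr_self : ∀ i x, pr i (pr i x) = pr i x
  pc_self : ∀ j x, pc j (pc j x) = pc j x
  pr_ne : ∀ i k x, i ≠ k → pr i (pr k x) = 0
  pc_ne : ∀ j k x, j ≠ k → pc j (pc k x) = 0
  comm : ∀ i j x, pr i (pc j x) = pc j (pr i x)

variable {F : Type v} [Field F] {A : Type u} [NonUnitalRing A] [Module F A]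
variable {n m : ℕ}

namespace RectGrading

/-- `A² ≠ 0`, and there are no proper nonzero ideals stable under the projections. -/
structure IsSimple (G : RectGrading F A n m) : Prop where
  mul_ne_zero : ∃ x y : A, x * y ≠ 0
  eq_bot_or_eq_top : ∀ I : Submodule F A, IsTwoSidedAlgIdeal I →
    (∀ i, ∀ x ∈ I, G.pr i x ∈ I) → (∀ j, ∀ x ∈ I, G.pc j x ∈ I) → I = ⊥ ∨ I = ⊤

variable {G : RectGrading F A n m}

theorem pr_of_ne {i k : Fin n} {x : A} (h : G.pr k x = x) (hik : i ≠ k) : G.pr i x = 0 := by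
  rw [← h, G.pr_ne i k x hik]

theorem pc_of_ne {i k : Fin m} {x : A} (h : G.pc k x = x) (hik : i ≠ k) : G.pc i x = 0 := by
  rw [← h, G.pc_ne i k x hik]

theorem pr_mul_of {i : Fin n} {x : A} (h : G.pr i x = x) (y : A) : G.pr i (x * y) = x * y := by
  rw [G.pr_mul, h]

theorem pc_mul_of {j : Fin m} {y : A} (h : G.pc j y = y) (x : A) : G.pc j (x * y) = x * y := by
  rw [G.pc_mul, h]

theorem sum_sum (x : A) : ∑ i, ∑ j, G.pr i (G.pc j x) = x := by
  simp_rw [← map_sum, G.sum_pc, G.sum_pr]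

theorem ext_pr {x y : A} (h : ∀ i, G.pr i x = G.pr i y) : x = y := by
  rw [← G.sum_pr x, ← G.sum_pr y]; exact Finset.sum_congr rfl fun i _ => h i

theorem ext_pc {x y : A} (h : ∀ j, G.pc j x = G.pc j y) : x = y := by
  rw [← G.sum_pc x, ← G.sum_pc y]; exact Finset.sum_congr rfl fun i _ => h i

namespace IsSimple

variable (hG : G.IsSimple)
include hG

theorem sq_span : Submodule.span F {z : A | ∃ x y, z = x * y} = ⊤ := by
  refine (hG.eq_bot_or_eq_top _ ?_ ?_ ?_).resolve_left ?_
  · intro a x hx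
    exact ⟨Submodule.subset_span ⟨a, x, rfl⟩, Submodule.subset_span ⟨x, a, rfl⟩⟩
  · intro i x hx
    induction hx using Submodule.span_induction with
    | mem x h =>
      obtain ⟨x, y, rfl⟩ := h
      exact Submodule.subset_span ⟨_, y, G.pr_mul i x y⟩
    | zero => simp
    | add x y _ _ hx hy => rw [map_add]; exact add_mem hx hy
    | smul c x _ hx => rw [map_smul]; exact Submodule.smul_mem _ _ hx
  · intro i x hx
    induction hx using Submodule.span_induction with
    | mem x h =>
      obtain ⟨x, y, rfl⟩ := h
      exact Submodule.subset_span ⟨x, _, G.pc_mul i x y⟩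
    | zero => simp
    | add x y _ _ hx hy => rw [map_add]; exact add_mem hx hy
    | smul c x _ hx => rw [map_smul]; exact Submodule.smul_mem _ _ hx
  · intro h
    obtain ⟨x, y, hxy⟩ := hG.mul_ne_zero
    exact hxy (by simpa [h] using
      (Submodule.subset_span ⟨x, y, rfl⟩ : x * y ∈ Submodule.span F {z : A | ∃ x y, z = x * y}))

theorem sq_induction {p : A → Prop} (h0 : p 0) (hadd : ∀ x y, p x → p y → p (x + y))
    (hsmul : ∀ (c : F) x, p x → p (c • x)) (hmul : ∀ x y, p (x * y)) (x : A) : p x := by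
  have hx : x ∈ Submodule.span F {z : A | ∃ x y, z = x * y} := by rw [hG.sq_span]; trivial
  induction hx using Submodule.span_induction with
  | mem x h => obtain ⟨x, y, rfl⟩ := h; exact hmul x y
  | zero => exact h0
  | add x y _ _ hx hy => exact hadd _ _ hx hy
  | smul c x _ hx => exact hsmul _ _ hx

variable [IsScalarTower F A A]

/-- Since A = A², the left factor of a nonzero product is a sum of products. -/
theorem exists_mul_mul_ne_zero : ∃ x a y : A, x * a * y ≠ 0 := by
  by_contra! h
  obtain ⟨x, y, hxy⟩ := hG.mul_ne_zero
  refine hxy ?_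
  induction x using hG.sq_induction with
  | h0 => simp
  | hadd x x' h h' =>
    by_cases h1 : x * y = 0
    · by_cases h2 : x' * y = 0
      · rw [add_mul, h1, h2, add_zero]
      · rw [add_mul, h1, h' h2, add_zero]
    · rw [add_mul, h h1]
      by_cases h2 : x' * y = 0
      · rw [h2, add_zero]
      · rw [h' h2, add_zero]
  | hsmul c x h1 =>
    by_cases h2 : x * y = 0
    · rw [smul_mul_assoc, h2, smul_zero]
    · rw [smul_mul_assoc, h1 h2, smul_zero]
  | hmul a b => exact h a b y

variable [SMulCommClass F A A]

/-- The products `x a y` with `a` in an ideal `I` span a graded ideal. -/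
theorem span_eq_bot_or_eq_top (I : Submodule F A) :
    Submodule.span F {z : A | ∃ x, ∃ a ∈ I, ∃ y, z = x * a * y} = ⊥ ∨
      Submodule.span F {z : A | ∃ x, ∃ a ∈ I, ∃ y, z = x * a * y} = ⊤ := by
  refine hG.eq_bot_or_eq_top _ ?_ ?_ ?_
  · intro b x hx
    induction hx using Submodule.span_induction with
    | mem x h =>
      obtain ⟨x, a, ha, y, rfl⟩ := h
      exact ⟨Submodule.subset_span ⟨b * x, a, ha, y, by simp only [mul_assoc]⟩,
        Submodule.subset_span ⟨x, a, ha, y * b, by simp only [mul_assoc]⟩⟩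
    | zero => simp
    | add x y _ _ hx hy =>
      rw [mul_add, add_mul]; exact ⟨add_mem hx.1 hy.1, add_mem hx.2 hy.2⟩
    | smul c x _ hx =>
      rw [mul_smul_comm, smul_mul_assoc]
      exact ⟨Submodule.smul_mem _ _ hx.1, Submodule.smul_mem _ _ hx.2⟩
  -- A row projection acts only on the leftmost factor of xay and a column projection only on the
  -- rightmost, so the span is homogeneous even if I is not.
  · intro i x hx
    induction hx using Submodule.span_induction with
    | mem x h =>
      obtain ⟨x, a, ha, y, rfl⟩ := h
      exact Submodule.subset_span
        ⟨G.pr i x, a, ha, y, by rw [mul_assoc, G.pr_mul, ← mul_assoc]⟩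
    | zero => simp
    | add x y _ _ hx hy => rw [map_add]; exact add_mem hx hy
    | smul c x _ hx => rw [map_smul]; exact Submodule.smul_mem _ _ hx
  · intro i x hx
    induction hx using Submodule.span_induction with
    | mem x h =>
      obtain ⟨x, a, ha, y, rfl⟩ := h
      exact Submodule.subset_span ⟨x, a, ha, _, by rw [G.pc_mul]⟩
    | zero => simp
    | add x y _ _ hx hy => rw [map_add]; exact add_mem hx hy
    | smul c x _ hx => rw [map_smul]; exact Submodule.smul_mem _ _ hx

/-- The span of AIA lies in I and is 0 or A. This extends graded simplicity to ideals that need not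
be homogeneous, such as the radical. -/
theorem ideal_eq_top_or (I : Submodule F A) (hI : IsTwoSidedAlgIdeal I) :
    I = ⊤ ∨ ∀ a ∈ I, ∀ x y, x * a * y = 0 := by
  rcases hG.span_eq_bot_or_eq_top I with h | h
  · right
    intro a ha x y
    rw [← Submodule.mem_bot F, ← h]
    exact Submodule.subset_span ⟨x, a, ha, y, rfl⟩
  · left
    rw [eq_top_iff, ← h, Submodule.span_le]
    rintro _ ⟨x, a, ha, y, rfl⟩
    exact (hI _ _ (hI _ _ ha).1).2

theorem triple_span : Submodule.span F {z : A | ∃ x a y, z = x * a * y} = ⊤ := by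
  have h := hG.span_eq_bot_or_eq_top ⊤
  simp only [Submodule.mem_top, true_and] at h
  refine h.resolve_left fun h => ?_
  obtain ⟨x, a, y, hne⟩ := hG.exists_mul_mul_ne_zero
  refine hne ?_
  rw [← Submodule.mem_bot F, ← h]
  exact Submodule.subset_span ⟨x, a, y, rfl⟩

/-- The elements all of whose components are annihilated from both sides form a homogeneous ideal,
which is not A because A³ ≠ 0. Once J(A) is known to be {a | AaA = 0}, this says that J(A) contains
no nonzero homogeneous ideal. -/
theorem eq_zero_of_components {a : A} (h : ∀ i j x y, x * G.pr i (G.pc j a) * y = 0) :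
    a = 0 := by
  let Z : Submodule F A :=
    { carrier := {a | ∀ i j x y, x * G.pr i (G.pc j a) * y = 0}
      zero_mem' := by intro i j x y; simp
      add_mem' := by
        intro a b ha hb i j x y
        rw [map_add, map_add, mul_add, add_mul, ha, hb, add_zero]
      smul_mem' := by
        intro c a ha i j x y
        rw [map_smul, map_smul, mul_smul_comm, smul_mul_assoc, ha, smul_zero] }
  have hZ : Z = ⊥ ∨ Z = ⊤ := by
    refine hG.eq_bot_or_eq_top Z ?_ ?_ ?_
    · intro b a ha
      refine ⟨fun i j x y => ?_, fun i j x y => ?_⟩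
      · rw [G.pc_mul, G.pr_mul, ← G.sum_pr (G.pc j a), Finset.mul_sum, Finset.mul_sum,
          Finset.sum_mul]
        refine Finset.sum_eq_zero fun k _ => ?_
        rw [← mul_assoc]
        exact ha k j _ y
      · rw [G.comm, G.pr_mul, G.pc_mul, ← G.sum_pc (G.pr i a), Finset.sum_mul, Finset.mul_sum,
          Finset.sum_mul]
        refine Finset.sum_eq_zero fun k _ => ?_
        rw [← G.comm, ← mul_assoc, mul_assoc]
        exact ha i k x _
    · intro k a ha i j x y
      rw [← G.comm k j a]
      by_cases hik : i = k
      · subst hik; rw [G.pr_self]; exact ha i j x y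
      · rw [G.pr_ne _ _ _ hik]; simp
    · intro k a ha i j x y
      by_cases hik : j = k
      · subst hik; rw [G.pc_self]; exact ha i j x y
      · rw [G.pc_ne _ _ _ hik]; simp
  rcases hZ with hZ | hZ
  · rw [← Submodule.mem_bot F, ← hZ]; exact h
  · exfalso
    obtain ⟨x, a, y, hne⟩ := hG.exists_mul_mul_ne_zero
    refine hne ?_
    have ha : a ∈ Z := by rw [hZ]; trivial
    rw [← G.sum_sum a, Finset.mul_sum, Finset.sum_mul]
    refine Finset.sum_eq_zero fun i _ => ?_
    rw [Finset.mul_sum, Finset.sum_mul]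
    exact Finset.sum_eq_zero fun j _ => ha i j x y

/-- A homogeneous element `a` with `AaA = 0` vanishes. -/
theorem eq_zero_of_homogeneous {a : A} {i : Fin n} {j : Fin m} (hi : G.pr i a = a)
    (hj : G.pc j a = a) (h : ∀ x y, x * a * y = 0) : a = 0 := by
  refine hG.eq_zero_of_components fun k l x y => ?_
  by_cases hl : l = j
  · subst hl
    by_cases hk : k = i
    · subst hk; rw [hj, hi, h]
    · rw [hj, pr_of_ne hi hk]; simp
  · rw [pc_of_ne hj hl]; simp

/-- An element `y` of a column ideal with `yA = 0` vanishes. -/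
theorem eq_zero_of_col {a : A} {j : Fin m} (hj : G.pc j a = a) (h : ∀ y, a * y = 0) : a = 0 := by
  refine hG.eq_zero_of_components fun k l x y => ?_
  by_cases hl : l = j
  · subst hl
    -- Right annihilation passes to the row components: pr_k(a)y = pr_k(ay) = 0.
    rw [hj, mul_assoc, ← G.pr_mul, h]; simp
  · rw [pc_of_ne hj hl]; simp

/-- An element `y` of a row ideal with `Ay = 0` vanishes. -/
theorem eq_zero_of_row {a : A} {i : Fin n} (hi : G.pr i a = a) (h : ∀ x, x * a = 0) : a = 0 := by
  refine hG.eq_zero_of_components fun k l x y => ?_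
  by_cases hk : k = i
  · subst hk
    rw [G.comm, hi, ← G.pc_mul, h]; simp
  · rw [G.comm, pr_of_ne hi hk]; simp

end IsSimple

end RectGrading

end RectGrading

/-! ### An identity modulo the radical -/

namespace RectGrading.IsSimple

variable {F : Type v} [Field F] {A : Type u} [NonUnitalRing A] [Module F A]
variable [IsScalarTower F A A] [SMulCommClass F A A] [FiniteDimensional F A] {n m : ℕ}
variable {G : RectGrading F A n m} (hG : G.IsSimple)
include hG

/-- An element of `A` that lies in the Jacobson radical of the unitization is annihilated from both
sides. -/
theorem mul_mul_eq_zero_of_inr_mem_jacobson {a : A}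
    (ha : (Unitization.inr a : Unitization F A) ∈ Ring.jacobson (Unitization F A)) (x y : A) :
    x * a * y = 0 := by
  have : Module.Finite F (Unitization F A) :=
    Module.Finite.equiv (Unitization.linearEquiv F F A).symm
  have : IsArtinianRing (Unitization F A) := IsArtinianRing.of_finite F _
  let N : Submodule F A := ((Ring.jacobson (Unitization F A)).restrictScalars F).comap
    (Unitization.inrNonUnitalAlgHom F A : A →ₗ[F] Unitization F A)
  have hmem : ∀ b : A, b ∈ N ↔
      (Unitization.inr b : Unitization F A) ∈ Ring.jacobson (Unitization F A) := fun _ => Iff.rfl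
  have hN : IsTwoSidedAlgIdeal N := by
    intro b x hx
    rw [hmem] at hx
    rw [hmem, hmem, Unitization.inr_mul, Unitization.inr_mul]
    exact ⟨Ideal.mul_mem_left _ _ hx, Ideal.mul_mem_right _ _ hx⟩
  -- If A lay in the nilpotent radical of its unitization, then A = A² would put A into every power
  -- of it, so A = 0.
  rcases hG.ideal_eq_top_or N hN with h | h
  · exfalso
    have hall : ∀ b : A, (Unitization.inr b : Unitization F A) ∈ Ring.jacobson (Unitization F A) :=
      fun b => by rw [← hmem, h]; trivial
    obtain ⟨k, hk⟩ := IsSemiprimaryRing.isNilpotent (R := Unitization F A)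
    have hpow : ∀ (k : ℕ) (b : A),
        (Unitization.inr b : Unitization F A) ∈ Ring.jacobson (Unitization F A) ^ k := by
      intro k
      induction k with
      | zero => intro b; rw [Submodule.pow_zero, Ideal.one_eq_top]; trivial
      | succ k ih =>
        intro b
        induction b using hG.sq_induction with
        | h0 => simp
        | hadd x y hx hy => rw [Unitization.inr_add]; exact add_mem hx hy
        | hsmul c x hx =>
          rw [Unitization.inr_smul, ← algebraMap_smul (Unitization F A) c]
          exact Submodule.smul_mem _ _ hx
        | hmul x y =>
          rw [Unitization.inr_mul, Submodule.pow_succ]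
          exact Ideal.mul_mem_mul (ih x) (hall y)
    obtain ⟨x, y, hxy⟩ := hG.mul_ne_zero
    have := hpow k (x * y)
    rw [hk, Submodule.zero_eq_bot, Submodule.mem_bot] at this
    exact hxy (Unitization.inr_injective (by rw [this, Unitization.inr_zero]))
  · exact h a ((hmem a).2 ha) x y

/-- There is an element acting as an identity modulo the elements annihilated from both sides. -/
theorem exists_right_unit : ∃ e : A, ∀ a x y : A, x * (a - a * e) * y = 0 := by
  have : Module.Finite F (Unitization F A) :=
    Module.Finite.equiv (Unitization.linearEquiv F F A).symm
  have : IsArtinianRing (Unitization F A) := IsArtinianRing.of_finite F _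
  let q : Unitization F A →+* Unitization F A ⧸ Ring.jacobson (Unitization F A) :=
    Ideal.Quotient.mk _
  have hq : Function.Surjective q := Ideal.Quotient.mk_surjective
  let I : Ideal (Unitization F A ⧸ Ring.jacobson (Unitization F A)) :=
    Ideal.map q (RingHom.ker (Unitization.fstHom F A))
  have hI : ∀ z, z ∈ I ↔ ∃ a : A, q (Unitization.inr a) = z := by
    intro z
    rw [Ideal.mem_map_iff_of_surjective q hq]
    constructor
    · rintro ⟨x, hx, rfl⟩
      refine ⟨x.snd, congrArg q ?_⟩
      have hx' : x.fst = 0 := hx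
      ext <;> simp [hx']
    · rintro ⟨a, rfl⟩
      exact ⟨_, by rw [RingHom.mem_ker]; simp, rfl⟩
  -- The image I of A is a left ideal of a semisimple ring. Splitting 1 = ē + k along I ⊕ K puts ā -
  -- āē = āk in I ∩ K = 0, so ē is a right identity of I.
  obtain ⟨K, hK⟩ := exists_isCompl I
  obtain ⟨z, hz, k, hk, hzk⟩ := Submodule.mem_sup.1
    (show (1 : Unitization F A ⧸ Ring.jacobson (Unitization F A)) ∈ I ⊔ K by
      rw [hK.sup_eq_top]; trivial)
  obtain ⟨e, rfl⟩ := (hI z).1 hz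
  refine ⟨e, fun a => hG.mul_mul_eq_zero_of_inr_mem_jacobson ?_⟩
  rw [← Ideal.Quotient.eq_zero_iff_mem]
  change q _ = 0
  refine Submodule.disjoint_def.1 hK.disjoint _ ((hI _).2 ⟨_, rfl⟩) ?_
  have : q (Unitization.inr (a - a * e)) = q (Unitization.inr a) * k := by
    rw [eq_sub_of_add_eq' hzk, Unitization.inr_sub, Unitization.inr_mul, map_sub, map_mul,
      mul_sub, mul_one]
  rw [this]
  exact Ideal.mul_mem_left _ _ hk

/-- There is an idempotent acting as an identity modulo the elements annihilated from both
sides. -/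
theorem exists_idem_unit : ∃ e : A, e * e = e ∧ e ≠ 0 ∧
    ∀ a x y : A, x * (a * e) * y = x * a * y ∧ x * (e * a) * y = x * a * y := by
  obtain ⟨e, he⟩ := hG.exists_right_unit
  have h1 : ∀ x a y : A, x * (a * e) * y = x * a * y := fun x a y => by
    have := he a x y
    rw [mul_sub, sub_mul, sub_eq_zero] at this
    exact this.symm
  -- A right identity modulo the radical is also a left one: for x = pq the e next to a is a right
  -- factor of q.
  have h2 : ∀ x a y : A, x * (e * a) * y = x * a * y := fun x a y => by
    rw [← sub_eq_zero]
    induction x using hG.sq_induction with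
    | h0 => simp
    | hadd x x' h h' =>
      rw [add_mul, add_mul, add_mul, add_mul, add_sub_add_comm, h, h', add_zero]
    | hsmul c x h => simp only [smul_mul_assoc, ← smul_sub, h, smul_zero]
    | hmul p q =>
      have := h1 p q (a * y)
      simp only [mul_assoc] at this ⊢
      rw [this, sub_self]
  have h1' : ∀ x a y : A, x * (a * (e * y)) = x * (a * y) := fun x a y => by
    simpa only [mul_assoc] using h1 x a y
  have h2' : ∀ a x y : A, x * (e * (a * y)) = x * (a * y) := fun a x y => by
    simpa only [mul_assoc] using h2 x a y
  -- An interior e can be deleted from a product as long as three factors remain, so e³ absorbs all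
  -- higher powers of e and is idempotent.
  refine ⟨e * e * e, ?_, ?_, ?_⟩
  · simp only [mul_assoc, h2']
  · intro h0
    obtain ⟨x, a, y, hne⟩ := hG.exists_mul_mul_ne_zero
    apply hne
    rw [← h2 x a y, ← h2 x (e * a) y, ← h2 x (e * (e * a)) y,
      show e * (e * (e * a)) = e * e * e * a by simp only [mul_assoc], h0]
    simp
  · intro a x y
    constructor
    · simp only [mul_assoc, h1']
    · simp only [mul_assoc, h2']

/-- The radical consists of the elements annihilated from both sides. -/
theorem mem_jacobsonRadical_iff {a : A} :
    a ∈ jacobsonRadical F A ↔ ∀ x y : A, x * a * y = 0 := by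
  constructor
  · rcases hG.ideal_eq_top_or _ (jacobsonRadical_isTwoSided (F := F) (A := A)) with h | h
    · exfalso
      obtain ⟨e, he, hne, -⟩ := hG.exists_idem_unit
      exact hne (eq_zero_of_idem_mem_jacobsonRadical (F := F) he (by rw [h]; trivial))
    · exact h a
  · intro h x
    refine isQuasiregular_of_sq_zero ?_
    rw [← mul_assoc, h, zero_mul]

end RectGrading.IsSimple

/-! ### Orthogonal idempotents in semisimple rings -/

section SemisimpleRing

/-- A finite family of submodules of a semisimple module can be shrunk to an independent one with
the same sum. -/
theorem exists_supIndep_le {R M : Type*} [Ring R] [AddCommGroup M] [Module R M]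
    [IsSemisimpleModule R M] {ι : Type*} [DecidableEq ι] (N : ι → Submodule R M) (s : Finset ι) :
    ∃ N' : ι → Submodule R M, (∀ i, N' i ≤ N i) ∧ s.SupIndep N' ∧ s.sup N' = s.sup N := by
  induction s using Finset.induction_on with
  | empty => exact ⟨N, fun _ => le_rfl, Finset.supIndep_empty _, rfl⟩
  | insert a s ha ih =>
    obtain ⟨N', h1, h2, h3⟩ := ih
    -- The new summand keeps only the part of `N a` complementary to its overlap with the earlier
    -- sum; the modular law shows that the total sum is unchanged.
    obtain ⟨K, hK⟩ := exists_isCompl (s.sup N ⊓ N a)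
    have hs : ∀ i ∈ s, Function.update N' a (K ⊓ N a) i = N' i := fun i hi =>
      Function.update_of_ne (fun h => ha (by rwa [h] at hi)) _ _
    have hsup : s.sup (Function.update N' a (K ⊓ N a)) = s.sup N := by
      rw [← h3]; exact Finset.sup_congr rfl hs
    refine ⟨Function.update N' a (K ⊓ N a), fun i => ?_, ?_, ?_⟩
    · by_cases h : i = a
      · subst h; rw [Function.update_self]; exact inf_le_right
      · rw [Function.update_of_ne h]; exact h1 i
    · refine Finset.SupIndep.insert ?_ ?_
      · intro t ht i hi hit
        rw [hs i hi, Finset.sup_congr rfl fun k hk => hs k (ht hk)]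
        exact h2 ht hi hit
      · rw [hsup, Function.update_self, disjoint_iff_inf_le, ← hK.inf_eq_bot]
        exact le_inf (le_inf inf_le_right (inf_le_left.trans inf_le_right))
          (inf_le_left.trans inf_le_left)
    · rw [Finset.sup_insert, Finset.sup_insert, hsup, Function.update_self]
      apply le_antisymm
      · exact sup_le_sup_right inf_le_right _
      · refine sup_le ?_ le_sup_right
        calc N a = (s.sup N ⊓ N a ⊔ K) ⊓ N a := by rw [hK.sup_eq_top, top_inf_eq]
          _ = s.sup N ⊓ N a ⊔ K ⊓ N a := sup_inf_assoc_of_le K inf_le_right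
          _ ≤ K ⊓ N a ⊔ s.sup N := sup_le (inf_le_left.trans le_sup_right) le_sup_left

/-- In a semisimple ring, left ideals `M j` whose sum is the whole ring contain orthogonal
idempotents with sum `1`. -/
theorem exists_orthogonal_idempotents {C : Type*} [Ring C] [IsSemisimpleRing C] {m : ℕ}
    (M : Fin m → Ideal C) (hM : ⨆ j, M j = ⊤) :
    ∃ ε : Fin m → C, (∀ j, ε j ∈ M j) ∧ (∀ j, ε j * ε j = ε j) ∧
      (∀ j k, j ≠ k → ε j * ε k = 0) ∧ ∑ j, ε j = 1 := by
  obtain ⟨N, h1, h2, h3⟩ := exists_supIndep_le M Finset.univ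
  have hind : iSupIndep N := by
    rw [iSupIndep_iff_supIndep_univ]; exact h2
  have htop : (1 : C) ∈ ⨆ j, N j := by
    rw [← Finset.sup_univ_eq_iSup, h3, Finset.sup_univ_eq_iSup, hM]; trivial
  obtain ⟨ε, hε, hsum⟩ := (Submodule.mem_iSup_iff_exists_finsupp N 1).1 htop
  rw [Finsupp.sum_fintype _ _ (fun _ => rfl)] at hsum
  -- The expansions ε_k = ∑_j ε_k ε_j and ε_k = ε_k both lie in ⨁ N_j, so their components agree.
  have key : ∀ k j, ε k * ε j - (if j = k then ε k else 0) = 0 := by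
    intro k
    refine hind.sum_eq_zero _ (fun j => ?_) ?_
    · refine sub_mem ((N j).smul_mem (ε k) (hε j)) ?_
      split_ifs with h
      · rw [← h]; exact hε j
      · exact zero_mem _
    · rw [Finset.sum_sub_distrib, ← Finset.mul_sum, hsum]; simp
  refine ⟨ε, fun j => h1 j (hε j), fun j => ?_, fun j k hjk => ?_, hsum⟩
  · simpa [sub_eq_zero] using key j j
  · simpa [hjk.symm] using key j k

end SemisimpleRing

/-! ### The corner eAe as a maximal semisimple complement of the radical -/

section Corner

variable {F : Type v} [Field F] {A : Type u} [NonUnitalRing A] [Module F A]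
variable [IsScalarTower F A A] [SMulCommClass F A A]

/-- The unital ring structure of a subalgebra with an identity element. -/
@[reducible] def NonUnitalSubalgebra.ringOfUnit (B : NonUnitalSubalgebra F A) (e : B)
    (he : ∀ b : B, e * b = b ∧ b * e = b) : Ring B :=
  { (inferInstance : NonUnitalRing B) with
    one := e
    one_mul := fun b => (he b).1
    mul_one := fun b => (he b).2 }

/-- An idempotent that acts as an identity element modulo the elements annihilated from both
sides. -/
structure IsUnitModRadical (e : A) : Prop where
  idem : e * e = e
  mul_mul : ∀ x a y : A, x * (a * (e * y)) = x * (a * y)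
  mul_mul' : ∀ x a y : A, x * (e * (a * y)) = x * (a * y)

variable (F) in
/-- The elements on which `e` acts as an identity from both sides. -/
def unitSubalgebra (e : A) : NonUnitalSubalgebra F A where
  carrier := {x | e * x = x ∧ x * e = x}
  zero_mem' := by simp
  add_mem' := by
    rintro x y ⟨h1, h2⟩ ⟨h3, h4⟩
    exact ⟨by rw [mul_add, h1, h3], by rw [add_mul, h2, h4]⟩
  mul_mem' := by
    rintro x y ⟨h1, h2⟩ ⟨h3, h4⟩
    exact ⟨by rw [← mul_assoc, h1], by rw [mul_assoc, h4]⟩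
  smul_mem' := by
    rintro c x ⟨h1, h2⟩
    exact ⟨by rw [mul_smul_comm, h1], by rw [smul_mul_assoc, h2]⟩

variable {e : A}

theorem sandwich_mem_unitSubalgebra (he : e * e = e) (a : A) :
    e * (a * e) ∈ unitSubalgebra F e :=
  ⟨by rw [← mul_assoc, he], by rw [mul_assoc, mul_assoc, he]⟩

theorem sandwich_eq_of_mem {x : A} (hx : x ∈ unitSubalgebra F e) : e * (x * e) = x := by
  rw [hx.2, hx.1]

variable [FiniteDimensional F A] {n m : ℕ} {G : RectGrading F A n m}

namespace RectGrading.IsSimple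

variable (hG : G.IsSimple)
include hG

theorem exists_isUnitModRadical : ∃ e : A, IsUnitModRadical e := by
  obtain ⟨e, h1, -, h2⟩ := hG.exists_idem_unit
  refine ⟨e, h1, fun x a y => ?_, fun x a y => ?_⟩
  · simpa only [mul_assoc] using (h2 a x y).1
  · simpa only [mul_assoc] using (h2 a x y).2

variable (he : IsUnitModRadical e)
include he

omit [FiniteDimensional F A] [SMulCommClass F A A] in
theorem unit_ne_zero : e ≠ 0 := by
  intro h
  obtain ⟨x, a, y, hne⟩ := hG.exists_mul_mul_ne_zero
  exact hne (by rw [mul_assoc, ← he.mul_mul, h]; simp)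

omit [FiniteDimensional F A] in
/-- The subalgebra `eAe` is simple. -/
theorem ideal_unitSubalgebra (T : Submodule F (unitSubalgebra F e))
    (hT : ∀ c : unitSubalgebra F e, ∀ t ∈ T, c * t ∈ T ∧ t * c ∈ T) : T = ⊥ ∨ T = ⊤ := by
  let π : A →ₗ[F] unitSubalgebra F e :=
    { toFun := fun a => ⟨e * (a * e), sandwich_mem_unitSubalgebra he.idem a⟩
      map_add' := fun a b => Subtype.ext (by simp [mul_add, add_mul])
      map_smul' := fun c a => Subtype.ext (by simp [mul_smul_comm, smul_mul_assoc]) }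
  -- Multiplicative because the middle e's can be deleted; ideals of eAe therefore pull back to
  -- ideals of A.
  have hπ : ∀ a b, π (a * b) = π a * π b := fun a b => Subtype.ext (by
    change e * (a * b * e) = e * (a * e) * (e * (b * e))
    simp only [mul_assoc, he.mul_mul])
  have hself : ∀ c : unitSubalgebra F e, π c = c := fun c => Subtype.ext (sandwich_eq_of_mem c.2)
  rcases hG.ideal_eq_top_or (T.comap π) (fun a x hx => by
    simp only [Submodule.mem_comap, hπ] at hx ⊢
    exact hT _ _ hx) with h | h
  · right
    rw [eq_top_iff]
    intro c _
    rw [← hself c]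
    have : (c : A) ∈ T.comap π := by rw [h]; trivial
    exact this
  · left
    rw [eq_bot_iff]
    intro c hc
    have := h c (by rw [Submodule.mem_comap, hself]; exact hc) e e
    rw [mul_assoc, sandwich_eq_of_mem c.2] at this
    rw [Submodule.mem_bot]
    exact Subtype.ext this

-- The corner has only trivial ideals, and its radical cannot contain the nonzero idempotent e.
omit [FiniteDimensional F A] in
theorem jacobsonRadical_unitSubalgebra : jacobsonRadical F (unitSubalgebra F e) = ⊥ := by
  refine (hG.ideal_unitSubalgebra he _ jacobsonRadical_isTwoSided).resolve_right fun h => ?_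
  have h2 : (⟨e, he.idem, he.idem⟩ : unitSubalgebra F e) = 0 :=
    eq_zero_of_idem_mem_jacobsonRadical (F := F) (Subtype.ext he.idem) (by rw [h]; trivial)
  exact hG.unit_ne_zero he (congrArg Subtype.val h2)

/-- The projection a ↦ eae has image eAe and kernel J(A): a - eae is annihilated from both sides. -/
theorem isCompl_unitSubalgebra :
    IsCompl (unitSubalgebra F e).toSubmodule (jacobsonRadical F A) := by
  constructor
  · rw [Submodule.disjoint_def]
    intro x hx hxJ
    rw [hG.mem_jacobsonRadical_iff] at hxJ
    have := hxJ e e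
    rwa [mul_assoc, sandwich_eq_of_mem (F := F) hx] at this
  · rw [codisjoint_iff, eq_top_iff]
    intro x _
    rw [← add_sub_cancel (e * (x * e)) x]
    refine Submodule.add_mem_sup (sandwich_mem_unitSubalgebra (F := F) he.idem x) ?_
    rw [hG.mem_jacobsonRadical_iff]
    intro a b
    simp only [mul_sub, sub_mul, mul_assoc, he.mul_mul, he.mul_mul', sub_self]

-- If C contains eAe and c is in C, then c - ece lies in C and is annihilated from both sides in A,
-- hence in the radical of C, which is zero.
omit [FiniteDimensional F A] in
theorem isMaximalSemisimple_unitSubalgebra : IsMaximalSemisimple (unitSubalgebra F e) := by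
  refine ⟨hG.jacobsonRadical_unitSubalgebra he, fun C hC hle c hc => ?_⟩
  have h1 : e * (c * e) ∈ unitSubalgebra F e := sandwich_mem_unitSubalgebra he.idem c
  have h2 : c - e * (c * e) ∈ C := sub_mem hc (hle h1)
  have h3 : (⟨_, h2⟩ : C) ∈ jacobsonRadical F C := by
    intro x
    refine isQuasiregular_of_sq_zero (Subtype.ext ?_)
    change (x : A) * (c - e * (c * e)) * (x * (c - e * (c * e))) = 0
    simp only [mul_sub, sub_mul, mul_assoc, he.mul_mul', sub_self]
  change jacobsonRadical F C = ⊥ at hC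
  rw [hC, Submodule.mem_bot] at h3
  have h5 : c - e * (c * e) = 0 := congrArg Subtype.val h3
  rw [sub_eq_zero.1 h5]
  exact h1

end RectGrading.IsSimple

end Corner

/-! ### Wedderburn structure of eAe and homogeneous idempotents modulo the radical -/

section Wedderburn

variable {F : Type v} [Field F] {A : Type u} [NonUnitalRing A] [Module F A]
variable [IsScalarTower F A A] [SMulCommClass F A A] {e : A}

variable (F) in
/-- The unital ring `eAe`. -/
@[reducible] def unitRing (he : e * e = e) : Ring (unitSubalgebra F e) :=
  NonUnitalSubalgebra.ringOfUnit _ ⟨e, he, he⟩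
    fun b => ⟨Subtype.ext b.2.1, Subtype.ext b.2.2⟩

variable (F) in
/-- The unital algebra `eAe`. -/
@[reducible] def unitAlgebra (he : e * e = e) :
    letI := unitRing F he
    Algebra F (unitSubalgebra F e) :=
  letI := unitRing F he
  Algebra.ofModule (fun c x y => smul_mul_assoc c x y) (fun c x y => mul_smul_comm c x y)

variable [FiniteDimensional F A] {n m : ℕ} {G : RectGrading F A n m}

namespace RectGrading.IsSimple

variable (hG : G.IsSimple) (he : IsUnitModRadical e)
include hG he

omit [FiniteDimensional F A] in
theorem isSimpleRing_unitSubalgebra :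
    letI := unitRing F he.idem
    IsSimpleRing (unitSubalgebra F e) := by
  let _ := unitRing F he.idem
  let _ := unitAlgebra F he.idem
  have : Nontrivial (unitSubalgebra F e) :=
    ⟨⟨1, 0, fun h => hG.unit_ne_zero he (congrArg Subtype.val h)⟩⟩
  refine IsSimpleRing.of_eq_bot_or_eq_top fun T => ?_
  let T' : Submodule F (unitSubalgebra F e) :=
    { carrier := {t | t ∈ T}
      zero_mem' := T.zero_mem
      add_mem' := fun ha hb => T.add_mem ha hb
      smul_mem' := fun c x hx => by
        change c • x ∈ T
        -- A ring ideal is a subspace because scalars act through multiples of 1 = e.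
        rw [← one_mul x, ← smul_mul_assoc]
        exact T.mul_mem_left _ _ hx }
  rcases hG.ideal_unitSubalgebra he T' (fun c t ht =>
    ⟨T.mul_mem_left _ _ ht, T.mul_mem_right _ _ ht⟩) with h | h
  · left
    rw [eq_bot_iff]
    intro t ht
    have : t ∈ T' := ht
    rw [h] at this
    exact this
  · right
    rw [eq_top_iff]
    intro t _
    have : t ∈ T' := by rw [h]; trivial
    exact this

theorem exists_matrix_equiv : ∃ (k : ℕ) (D : Type u) (_ : DivisionRing D) (_ : Algebra F D),
    0 < k ∧ FiniteDimensional F D ∧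
    (∃ Ψ : unitSubalgebra F e →ₙₐ[F] Matrix (Fin k) (Fin k) D, Function.Bijective Ψ) ∧
    Module.finrank F (unitSubalgebra F e) = k ^ 2 * Module.finrank F D := by
  have hfin : Module.Finite F (unitSubalgebra F e) :=
    inferInstanceAs (Module.Finite F (unitSubalgebra F e).toSubmodule)
  let _ := unitRing F he.idem
  let _ := unitAlgebra F he.idem
  have := hG.isSimpleRing_unitSubalgebra he
  have : IsArtinianRing (unitSubalgebra F e) := IsArtinianRing.of_finite F _
  obtain ⟨k, hk, D, i1, i2, i3, ⟨Ψ⟩⟩ :=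
    IsSimpleRing.exists_algEquiv_matrix_divisionRing_finite F (unitSubalgebra F e)
  refine ⟨k, D, i1, i2, Nat.pos_of_ne_zero hk.out, i3,
    ⟨⟨⟨⟨Ψ, fun c x => map_smul Ψ c x⟩, map_zero Ψ, map_add Ψ⟩, map_mul Ψ⟩, Ψ.bijective⟩, ?_⟩
  have h1 : Module.finrank F (unitSubalgebra F e)
      = Module.finrank F (Matrix (Fin k) (Fin k) D) := LinearEquiv.finrank_eq Ψ.toLinearEquiv
  rw [h1, Module.finrank_matrix]
  simp [sq]

-- The left ideals eL_je span the semisimple ring eAe, so they contain orthogonal idempotents ε_j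
-- summing to e. The h_j are preimages of the ε_j in L_j under a ↦ eae, so they satisfy the
-- idempotent relations only modulo the radical, that is, between two flanking factors.
omit he in
theorem exists_col_idempotents : ∃ h : Fin m → A, (∀ j, G.pc j (h j) = h j) ∧
    (∀ j x y, x * (h j * (h j * y)) = x * (h j * y)) ∧
    (∀ j k, j ≠ k → ∀ x y, x * (h j * (h k * y)) = 0) ∧
    (∀ x a y, ∑ j, x * (a * (h j * y)) = x * (a * y)) := by
  obtain ⟨e, he⟩ := hG.exists_isUnitModRadical
  have hfin : Module.Finite F (unitSubalgebra F e) :=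
    inferInstanceAs (Module.Finite F (unitSubalgebra F e).toSubmodule)
  let _ := unitRing F he.idem
  let _ := unitAlgebra F he.idem
  have := hG.isSimpleRing_unitSubalgebra he
  have : IsArtinianRing (unitSubalgebra F e) := IsArtinianRing.of_finite F _
  let M : Fin m → Ideal (unitSubalgebra F e) := fun j =>
    { carrier := {c | ∃ x, G.pc j x = x ∧ e * (x * e) = c}
      zero_mem' := ⟨0, by simp⟩
      add_mem' := by
        rintro a b ⟨x, hx, hx'⟩ ⟨y, hy, hy'⟩
        refine ⟨x + y, by rw [map_add, hx, hy], ?_⟩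
        rw [add_mul, mul_add, hx', hy']; rfl
      smul_mem' := by
        rintro c b ⟨y, hy, hy'⟩
        refine ⟨c * y, by rw [G.pc_mul, hy], ?_⟩
        change _ = (c : A) * b
        rw [← hy']
        have h2 := c.2.2
        have h1 := c.2.1
        rw [mul_assoc, ← mul_assoc e, h1, ← mul_assoc (c : A) e, h2] }
  have hM : ⨆ j, M j = ⊤ := by
    rw [eq_top_iff]
    intro c _
    have : c = ∑ j, (⟨e * (G.pc j c * e), sandwich_mem_unitSubalgebra he.idem _⟩ :
        unitSubalgebra F e) := by
      apply Subtype.ext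
      rw [AddSubmonoidClass.coe_finsetSum, ← Finset.mul_sum, ← Finset.sum_mul, G.sum_pc,
        sandwich_eq_of_mem c.2]
    rw [this]
    exact Submodule.sum_mem _ fun j _ =>
      Submodule.mem_iSup_of_mem j ⟨G.pc j c, G.pc_self j _, rfl⟩
  obtain ⟨ε, hε, h1, h2, h3⟩ := exists_orthogonal_idempotents M hM
  choose h hh he' using hε
  have hs : ∀ x b y : A, x * (b * y) = x * (e * (b * e) * y) := fun x b y => by
    simp only [mul_assoc, he.mul_mul, he.mul_mul']
  -- Between flanking factors, h_j and ε_j = e h_j e are interchangeable.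
  have key : ∀ j k x y, x * (h j * (h k * y)) = x * ((ε j * ε k : unitSubalgebra F e) * y) := by
    intro j k x y
    change _ = x * ((ε j : A) * ε k * y)
    rw [← he' j, ← he' k]
    simp only [mul_assoc, he.mul_mul, he.mul_mul']
  refine ⟨h, hh, fun j x y => ?_, fun j k hjk x y => ?_, fun x a y => ?_⟩
  · rw [key, h1, hs x (h j) y, he']
  · rw [key, h2 j k hjk]; simp
  · have h4 : ∑ j, (ε j : A) = e := by
      rw [← AddSubmonoidClass.coe_finsetSum, h3]; rfl
    have h5 : ∀ j, x * (a * (h j * y)) = x * a * (ε j * y) := fun j => by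
      rw [← mul_assoc, hs (x * a) (h j) y, he']
    rw [Finset.sum_congr rfl fun j _ => h5 j, ← Finset.mul_sum, ← Finset.sum_mul, h4, mul_assoc,
      he.mul_mul]

-- The mirror image of the column case: the right ideals eR_ie are left ideals of the opposite ring.
omit he in
theorem exists_row_idempotents : ∃ h : Fin n → A, (∀ j, G.pr j (h j) = h j) ∧
    (∀ j x y, x * (h j * (h j * y)) = x * (h j * y)) ∧
    (∀ j k, j ≠ k → ∀ x y, x * (h j * (h k * y)) = 0) ∧
    (∀ x a y, ∑ j, x * (a * (h j * y)) = x * (a * y)) := by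
  obtain ⟨e, he⟩ := hG.exists_isUnitModRadical
  have hfin : Module.Finite F (unitSubalgebra F e) :=
    inferInstanceAs (Module.Finite F (unitSubalgebra F e).toSubmodule)
  let _ := unitRing F he.idem
  let _ := unitAlgebra F he.idem
  have := hG.isSimpleRing_unitSubalgebra he
  have : IsArtinianRing (unitSubalgebra F e) := IsArtinianRing.of_finite F _
  let M : Fin n → Ideal (unitSubalgebra F e)ᵐᵒᵖ := fun j =>
    { carrier := {c | ∃ x, G.pr j x = x ∧ e * (x * e) = c.unop}
      zero_mem' := ⟨0, by simp⟩
      add_mem' := by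
        rintro a b ⟨x, hx, hx'⟩ ⟨y, hy, hy'⟩
        refine ⟨x + y, by rw [map_add, hx, hy], ?_⟩
        rw [add_mul, mul_add, hx', hy']; rfl
      smul_mem' := by
        rintro c b ⟨y, hy, hy'⟩
        refine ⟨y * c.unop, by rw [G.pr_mul, hy], ?_⟩
        change _ = (b.unop : A) * c.unop
        rw [← hy', mul_assoc, mul_assoc, mul_assoc, c.unop.2.1, c.unop.2.2] }
  have hM : ⨆ j, M j = ⊤ := by
    rw [eq_top_iff]
    intro c _
    have : c = MulOpposite.op (∑ j, (⟨e * (G.pr j c.unop * e), sandwich_mem_unitSubalgebra he.idem _⟩ :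
        unitSubalgebra F e)) := by
      apply MulOpposite.unop_injective
      apply Subtype.ext
      rw [MulOpposite.unop_op, AddSubmonoidClass.coe_finsetSum, ← Finset.mul_sum, ← Finset.sum_mul, G.sum_pr,
        sandwich_eq_of_mem c.unop.2]
    rw [this, Finset.op_sum]
    exact Submodule.sum_mem _ fun j _ =>
      Submodule.mem_iSup_of_mem j ⟨G.pr j c.unop, G.pr_self j _, rfl⟩
  obtain ⟨ε', hε, h1', h2', h3'⟩ := exists_orthogonal_idempotents M hM
  obtain ⟨ε, rfl⟩ : ∃ ε : Fin n → unitSubalgebra F e, ε' = fun j => MulOpposite.op (ε j) :=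
    ⟨fun j => (ε' j).unop, rfl⟩
  have h1 : ∀ j, ε j * ε j = ε j := fun j => MulOpposite.op_injective (h1' j)
  have h2 : ∀ j k, j ≠ k → ε j * ε k = 0 := fun j k hjk =>
    MulOpposite.op_injective (h2' k j hjk.symm)
  have h3 : ∑ j, ε j = 1 := MulOpposite.op_injective (by rw [Finset.op_sum]; exact h3')
  choose h hh he₀ using hε
  have he' : ∀ j, e * (h j * e) = ε j := he₀
  have hs : ∀ x b y : A, x * (b * y) = x * (e * (b * e) * y) := fun x b y => by
    simp only [mul_assoc, he.mul_mul, he.mul_mul']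
  have key : ∀ j k x y, x * (h j * (h k * y)) = x * ((ε j * ε k : unitSubalgebra F e) * y) := by
    intro j k x y
    change _ = x * ((ε j : A) * ε k * y)
    rw [← he' j, ← he' k]
    simp only [mul_assoc, he.mul_mul, he.mul_mul']
  refine ⟨h, hh, fun j x y => ?_, fun j k hjk x y => ?_, fun x a y => ?_⟩
  · rw [key, h1, hs x (h j) y, he']
  · rw [key, h2 j k hjk]; simp
  · have h4 : ∑ j, (ε j : A) = e := by
      rw [← AddSubmonoidClass.coe_finsetSum, h3]; rfl
    have h5 : ∀ j, x * (a * (h j * y)) = x * a * (ε j * y) := fun j => by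
      rw [← mul_assoc, hs (x * a) (h j) y, he']
    rw [Finset.sum_congr rfl fun j _ => h5 j, ← Finset.mul_sum, ← Finset.sum_mul, h4, mul_assoc,
      he.mul_mul]

end RectGrading.IsSimple

end Wedderburn

/-! ### Projections of a finite direct sum -/

section Projections

variable {F : Type v} [Field F] {A : Type u} [AddCommGroup A] [Module F A]

/-- The projections onto the summands of a finite direct sum decomposition. -/
theorem exists_projections {ι : Type*} [Fintype ι] [DecidableEq ι] (M : ι → Submodule F A)
    (h : iSupIndep M) (htop : ⨆ i, M i = ⊤) :
    ∃ p : ι → A →ₗ[F] A, (∀ i x, p i x ∈ M i) ∧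
      (∀ i k, ∀ x ∈ M k, p i x = if i = k then x else 0) ∧ ∀ x, ∑ i, p i x = x := by
  have hint := DirectSum.isInternal_submodule_of_iSupIndep_of_iSup_eq_top h htop
  let E : DirectSum ι (fun i => M i) ≃ₗ[F] A :=
    LinearEquiv.ofBijective (DirectSum.coeLinearMap M) hint
  have hE : ∀ i (x : M i), E.symm x = DirectSum.lof F ι (fun i => M i) i x := by
    intro i x
    rw [LinearEquiv.symm_apply_eq]
    exact (DirectSum.coeLinearMap_lof M i x).symm
  have hp : ∀ i k, ∀ x ∈ M k, ((M i).subtype ∘ₗ DirectSum.component F ι (fun i => M i) i ∘ₗ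
      E.symm.toLinearMap) x = if i = k then x else 0 := by
    intro i k x hx
    change ((DirectSum.component F ι (fun i => M i) i (E.symm ((⟨x, hx⟩ : M k) : A)) : M i) : A) = _
    rw [hE]
    split_ifs with hik
    · subst hik; rw [DirectSum.component.lof_self]
    · rw [DirectSum.component.of, dif_neg (Ne.symm hik)]; rfl
  refine ⟨fun i => (M i).subtype ∘ₗ DirectSum.component F ι (fun i => M i) i ∘ₗ
    E.symm.toLinearMap, fun i x => Subtype.mem _, hp, fun x => ?_⟩
  have hx : x ∈ ⨆ i, M i := by rw [htop]; trivial
  induction hx using Submodule.iSup_induction' with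
  | mem i x hx => simp_rw [hp _ i x hx]; simp
  | zero => simp
  | add x y _ _ hx hy => simp only [map_add, Finset.sum_add_distrib, hx, hy]

end Projections

/-! ### From the semigroup grading to row and column projections -/

section Compatibility

variable {F : Type v} [Field F] {A : Type u} [NonUnitalRing A] [Module F A]
variable {n m : ℕ} {P : Fin m → Fin n → WithZero Unit}

/-- The projections of `G` are those of the grading `𝒜`. -/
structure RectGrading.IsCompatible (G : RectGrading F A n m)
    (𝒜 : ReesMatrixSemigroup P → Submodule F A) : Prop where
  mem_homComp : ∀ i j x, x ∈ homComp 𝒜 i j ↔ G.pr i x = x ∧ G.pc j x = x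
  mem_colIdeal : ∀ j x, x ∈ colIdeal 𝒜 j ↔ G.pc j x = x
  mem_rowIdeal : ∀ i x, x ∈ rowIdeal 𝒜 i ↔ G.pr i x = x

theorem exists_isCompatible [IsScalarTower F A A] [SMulCommClass F A A]
    (𝒜 : ReesMatrixSemigroup P → Submodule F A) (h𝒜 : IsSemigroupGrading 𝒜) (hzero : 𝒜 0 = ⊥) :
    ∃ G : RectGrading F A n m, G.IsCompatible 𝒜 := by
  let M : Fin n × Fin m → Submodule F A := fun q => homComp 𝒜 q.1 q.2
  have hind : iSupIndep M :=
    h𝒜.isDirectSum.1.comp (f := fun q : Fin n × Fin m => ReesMatrixSemigroup.elt 1 q.1 q.2)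
      (fun q r hqr => by
        simp only [ReesMatrixSemigroup.elt.injEq, true_and] at hqr
        exact Prod.ext hqr.1 hqr.2)
  have htop : ⨆ q, M q = ⊤ := by
    rw [eq_top_iff, ← h𝒜.isDirectSum.2]
    refine iSup_le fun s => ?_
    cases s with
    | zero => exact hzero.le.trans bot_le
    | elt g i j => exact le_iSup M (i, j)
  have hmul : ∀ i j k l, ∀ x ∈ M (i, j), ∀ y ∈ M (k, l), x * y ∈ M (i, l) := by
    intro i j k l x hx y hy
    have h1 := h𝒜.mul_mem _ _ x y hx hy
    rw [ReesMatrixSemigroup.elt_mul_elt] at h1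
    -- If the sandwich entry is zero the product vanishes, so A_ij A_kl ⊆ A_il in either case and
    -- the matrix is not needed again.
    generalize hz : ((1 : Unit) : WithZero Unit) * P j k * ((1 : Unit) : WithZero Unit) = z at h1
    induction z using WithZero.recZeroCoe with
    | zero =>
      rw [ReesMatrixSemigroup.triple_zero, hzero, Submodule.mem_bot] at h1
      rw [h1]; exact zero_mem _
    | coe g => rwa [ReesMatrixSemigroup.triple_coe] at h1
  obtain ⟨p, hp1, hp2, hp3⟩ := exists_projections M hind htop
  have hM : ∀ {q : A → Prop} (mem : ∀ i j, ∀ x ∈ M (i, j), q x) (zero : q 0)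
      (add : ∀ x y, q x → q y → q (x + y)) (x : A), q x := by
    intro q h1 h2 h3 x
    have hx : x ∈ ⨆ i, M i := by rw [htop]; trivial
    exact Submodule.iSup_induction M (motive := q) hx (fun i x hx => h1 i.1 i.2 x hx) h2 h3
  let pr : Fin n → A →ₗ[F] A := fun i => ∑ j, p (i, j)
  let pc : Fin m → A →ₗ[F] A := fun j => ∑ i, p (i, j)
  have hpr : ∀ i k l, ∀ x ∈ M (k, l), pr i x = if i = k then x else 0 := by
    intro i k l x hx
    simp only [pr, LinearMap.sum_apply, hp2 _ _ x hx, Prod.mk.injEq]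
    split_ifs with h <;> simp [h]
  have hpc : ∀ j k l, ∀ x ∈ M (k, l), pc j x = if j = l then x else 0 := by
    intro j k l x hx
    simp only [pc, LinearMap.sum_apply, hp2 _ _ x hx, Prod.mk.injEq]
    split_ifs with h <;> simp [h]
  have hcomp : ∀ i j x, pr i (pc j x) = p (i, j) x := by
    intro i j
    refine hM (fun k l x hx => ?_) (by simp) (fun x y hx hy => by simp only [map_add, hx, hy])
    rw [hpc j k l x hx, hp2 _ _ x hx]
    by_cases h : j = l
    · rw [if_pos h, hpr i k l x hx]; simp [h]
    · simp [h]
  let G : RectGrading F A n m :=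
    { pr := pr
      pc := pc
      pr_mul := by
        intro i x y
        induction x using hM with
        | mem k l x hx =>
          induction y using hM with
          | mem k' l' y hy =>
            rw [hpr i k l x hx, hpr i k l' _ (hmul k l k' l' x hx y hy)]
            split_ifs <;> simp
          | zero => simp
          | add y y' h h' => simp only [mul_add, map_add, h, h']
        | zero => simp
        | add x x' h h' => simp only [add_mul, map_add, h, h']
      pc_mul := by
        intro i x y
        induction x using hM with
        | mem k l x hx =>
          induction y using hM with
          | mem k' l' y hy =>
            rw [hpc i k' l' y hy, hpc i k l' _ (hmul k l k' l' x hx y hy)]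
            split_ifs <;> simp
          | zero => simp
          | add y y' h h' => simp only [mul_add, map_add, h, h']
        | zero => simp
        | add x x' h h' => simp only [add_mul, map_add, h, h']
      sum_pr := by
        refine hM (fun k l x hx => ?_) (by simp)
          (fun x y hx hy => by simp only [map_add, Finset.sum_add_distrib, hx, hy])
        simp_rw [hpr _ k l x hx]; simp
      sum_pc := by
        refine hM (fun k l x hx => ?_) (by simp)
          (fun x y hx hy => by simp only [map_add, Finset.sum_add_distrib, hx, hy])
        simp_rw [hpc _ k l x hx]; simp
      pr_self := by
        intro i
        refine hM (fun k l x hx => ?_) (by simp) (fun x y hx hy => by simp only [map_add, hx, hy])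
        rw [hpr i k l x hx]
        split_ifs with h
        · rw [hpr i k l x hx, if_pos h]
        · simp
      pc_self := by
        intro i
        refine hM (fun k l x hx => ?_) (by simp) (fun x y hx hy => by simp only [map_add, hx, hy])
        rw [hpc i k l x hx]
        split_ifs with h
        · rw [hpc i k l x hx, if_pos h]
        · simp
      pr_ne := by
        intro i i' x hi
        induction x using hM with
        | mem k l x hx =>
          rw [hpr i' k l x hx]
          split_ifs with h
          · rw [hpr i k l x hx, if_neg (h ▸ hi)]
          · simp
        | zero => simp
        | add x y hx hy => simp only [map_add, hx, hy, add_zero]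
      pc_ne := by
        intro i i' x hi
        induction x using hM with
        | mem k l x hx =>
          rw [hpc i' k l x hx]
          split_ifs with h
          · rw [hpc i k l x hx, if_neg (h ▸ hi)]
          · simp
        | zero => simp
        | add x y hx hy => simp only [map_add, hx, hy, add_zero]
      comm := by
        intro i j x
        induction x using hM with
        | mem k l x hx =>
          rw [hpr i k l x hx, hpc j k l x hx]
          by_cases h1 : j = l <;> by_cases h2 : i = k <;>
            simp [h1, h2, hpr _ k l x hx, hpc _ k l x hx]
        | zero => simp
        | add x y hx hy => simp only [map_add, hx, hy] }
  refine ⟨G, fun i j x => ⟨fun hx => ⟨?_, ?_⟩, fun hx => ?_⟩, fun j x => ⟨fun hx => ?_, fun hx => ?_⟩,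
    fun i x => ⟨fun hx => ?_, fun hx => ?_⟩⟩
  · exact (hpr i i j x hx).trans (if_pos rfl)
  · exact (hpc j i j x hx).trans (if_pos rfl)
  · have h1 : pr i x = x := hx.1
    have h2 : pc j x = x := hx.2
    rw [← h1, ← h2, hcomp]
    exact hp1 (i, j) x
  · change pc j x = x
    refine Submodule.iSup_induction _ (motive := fun x => pc j x = x) hx (fun k x hx => ?_)
      (map_zero _) (fun x y hx hy => by rw [map_add, hx, hy])
    rw [hpc j k j x hx, if_pos rfl]
  · have h1 : pc j x = x := hx
    rw [← h1]
    simp only [pc, LinearMap.sum_apply]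
    exact Submodule.sum_mem _ fun k _ => Submodule.mem_iSup_of_mem k (hp1 (k, j) x)
  · change pr i x = x
    refine Submodule.iSup_induction _ (motive := fun x => pr i x = x) hx (fun k x hx => ?_)
      (map_zero _) (fun x y hx hy => by rw [map_add, hx, hy])
    rw [hpr i i k x hx, if_pos rfl]
  · have h1 : pr i x = x := hx
    rw [← h1]
    simp only [pr, LinearMap.sum_apply]
    exact Submodule.sum_mem _ fun k _ => Submodule.mem_iSup_of_mem k (hp1 (i, k) x)

/-- An ideal stable under all projections contains the homogeneous components of its elements, hence
is a homogeneous ideal for the grading. -/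
theorem RectGrading.IsCompatible.isSimple {G : RectGrading F A n m}
    {𝒜 : ReesMatrixSemigroup P → Submodule F A} (hc : G.IsCompatible 𝒜)
    (hind : iSupIndep 𝒜) (hs : IsGradedSimple 𝒜) : G.IsSimple := by
  refine ⟨hs.mul_ne_zero, fun I hI hr hl => hs.eq_bot_or_eq_top I hI
    ⟨hind.mono fun s => inf_le_left, le_antisymm (iSup_le fun s => inf_le_right) fun x hx => ?_⟩⟩
  rw [← G.sum_sum x]
  refine Submodule.sum_mem _ fun i _ => Submodule.sum_mem _ fun j _ => ?_
  refine Submodule.mem_iSup_of_mem (.elt 1 i j) ⟨(hc.mem_homComp i j _).2 ⟨G.pr_self _ _, ?_⟩,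
    hr i _ (hl j _ hx)⟩
  rw [← G.comm, G.pc_self]

end Compatibility

/-! ### Exact homogeneous idempotents and the decompositions they define -/

section Idempotents

variable {F : Type v} [Field F] {A : Type u} [NonUnitalRing A] [Module F A] {n m : ℕ}

/-- Orthogonal idempotents `f' i` in the row ideals and `f j` in the column ideals with the same
sum, which is an identity element modulo the radical. -/
structure RectIdempotents (G : RectGrading F A n m) (f' : Fin n → A) (f : Fin m → A) : Prop where
  idem_row : ∀ i, f' i * f' i = f' i
  orth_row : ∀ i k, i ≠ k → f' i * f' k = 0
  idem_col : ∀ j, f j * f j = f j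
  orth_col : ∀ j k, j ≠ k → f j * f k = 0
  pr_row : ∀ i, G.pr i (f' i) = f' i
  pc_col : ∀ j, G.pc j (f j) = f j
  sum_eq : ∑ i, f' i = ∑ j, f j
  isUnit : IsUnitModRadical (∑ j, f j)

section OrthogonalSum

variable {ι : Type*} [Fintype ι] {f : ι → A}
  (h1 : ∀ i, f i * f i = f i) (h2 : ∀ i k, i ≠ k → f i * f k = 0)
include h1 h2

theorem mul_sum_orthogonal (i : ι) : f i * ∑ k, f k = f i := by
  rw [Finset.mul_sum, Finset.sum_eq_single i (fun k _ hk => h2 i k hk.symm) (by simp), h1]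

theorem sum_orthogonal_mul (i : ι) : (∑ k, f k) * f i = f i := by
  rw [Finset.sum_mul, Finset.sum_eq_single i (fun k _ hk => h2 k i hk) (by simp), h1]

theorem sum_orthogonal_mul_sum : (∑ k, f k) * ∑ k, f k = ∑ k, f k := by
  rw [Finset.sum_mul]
  exact Finset.sum_congr rfl fun i _ => mul_sum_orthogonal h1 h2 i

end OrthogonalSum

/-- With r = ∑ g_i² and l = ∑ h_j², both identities modulo the radical, put f'_i = g_i² l and f_j =
r h_j². Multiplying by r on the left does not move h_j² out of L_j, and similarly for rows, and both
families sum to rl. The squares supply the outer factors that turn relations modulo the radical into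
exact ones. -/
theorem RectGrading.IsSimple.exists_rectIdempotents [IsScalarTower F A A] [SMulCommClass F A A]
    [FiniteDimensional F A] {G : RectGrading F A n m} (hG : G.IsSimple) :
    ∃ (f' : Fin n → A) (f : Fin m → A), RectIdempotents G f' f := by
  obtain ⟨h, hh, h1, h2, h3⟩ := hG.exists_col_idempotents
  obtain ⟨g, hg, g1, g2, g3⟩ := hG.exists_row_idempotents
  obtain ⟨e, he⟩ := hG.exists_isUnitModRadical
  set r : A := ∑ i, g i * g i with hr
  set l : A := ∑ j, h j * h j with hl
  have hl1 : ∀ x a y : A, x * (a * (l * y)) = x * (a * y) := fun x a y => by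
    rw [hl, Finset.sum_mul, Finset.mul_sum, Finset.mul_sum, ← h3]
    exact Finset.sum_congr rfl fun j _ => by rw [mul_assoc, h1]
  have hr1 : ∀ x a y : A, x * (a * (r * y)) = x * (a * y) := fun x a y => by
    rw [hr, Finset.sum_mul, Finset.mul_sum, Finset.mul_sum, ← g3]
    exact Finset.sum_congr rfl fun j _ => by rw [mul_assoc, g1]
  have hl2 : ∀ x a y : A, x * (l * (a * y)) = x * (a * y) := fun x a y => by
    rw [← he.mul_mul' x l, hl1, he.mul_mul']
  have hr2 : ∀ x a y : A, x * (r * (a * y)) = x * (a * y) := fun x a y => by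
    rw [← he.mul_mul' x r, hr1, he.mul_mul']
  have hrow1 : ∀ i, g i * (g i * l) * (g i * (g i * l)) = g i * (g i * l) := fun i => by
    simp only [mul_assoc, hl2, g1]
  have hrow2 : ∀ i k, i ≠ k → g i * (g i * l) * (g k * (g k * l)) = 0 := fun i k hik => by
    simp only [mul_assoc, hl2]; rw [g2 i k hik]
  have hcol1 : ∀ j, r * (h j * h j) * (r * (h j * h j)) = r * (h j * h j) := fun j => by
    simp only [mul_assoc, hr2, h1]
  have hcol2 : ∀ j k, j ≠ k → r * (h j * h j) * (r * (h k * h k)) = 0 := fun j k hjk => by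
    simp only [mul_assoc, hr1]; rw [← mul_assoc r, h2 j k hjk]
  have hsum : ∑ i, g i * (g i * l) = ∑ j, r * (h j * h j) := by
    rw [← Finset.mul_sum, ← hl, hr, Finset.sum_mul]
    exact Finset.sum_congr rfl fun i _ => by rw [mul_assoc]
  refine ⟨fun i => g i * (g i * l), fun j => r * (h j * h j),
    ⟨hrow1, hrow2, hcol1, hcol2, fun i => ?_, fun j => ?_, hsum,
      ⟨sum_orthogonal_mul_sum hcol1 hcol2, fun x a y => ?_, fun x a y => ?_⟩⟩⟩
  · exact G.pr_mul_of (hg i) _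
  · exact G.pc_mul_of (G.pc_mul_of (hh j) _) _
  · rw [← Finset.mul_sum, ← hl, mul_assoc, hr1, hl1]
  · rw [← Finset.mul_sum, ← hl, mul_assoc, hl2, hr2]

namespace RectIdempotents

variable {G : RectGrading F A n m} {f' : Fin n → A} {f : Fin m → A} (H : RectIdempotents G f' f)
include H

theorem row_mul_unit (i : Fin n) : f' i * ∑ l, f l = f' i := by
  rw [← H.sum_eq]; exact mul_sum_orthogonal H.idem_row H.orth_row i

theorem unit_mul_row (i : Fin n) : (∑ l, f l) * f' i = f' i := by
  rw [← H.sum_eq]; exact sum_orthogonal_mul H.idem_row H.orth_row i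

theorem col_mul_unit (j : Fin m) : f j * ∑ l, f l = f j :=
  mul_sum_orthogonal H.idem_col H.orth_col j

theorem unit_mul_col (j : Fin m) : (∑ l, f l) * f j = f j :=
  sum_orthogonal_mul H.idem_col H.orth_col j

theorem pr_row_mul (i : Fin n) (x : A) : G.pr i (f' i * x) = f' i * x :=
  G.pr_mul_of (H.pr_row i) x

theorem pc_mul_col (j : Fin m) (x : A) : G.pc j (x * f j) = x * f j :=
  G.pc_mul_of (H.pc_col j) x

/-- Writing e as the sum of the f'_k separates the rows of ex. With its column analogue, this lets
the row and column projections turn multiplication by e into multiplication by f'_i or f_j. -/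
theorem pr_unit_mul (i : Fin n) (x : A) : G.pr i ((∑ l, f l) * x) = f' i * x := by
  rw [← H.sum_eq, Finset.sum_mul, map_sum, Finset.sum_eq_single i, H.pr_row_mul]
  · intro k _ hk
    rw [G.pr_mul, G.pr_of_ne (H.pr_row k) hk.symm, zero_mul]
  · simp

theorem pc_mul_unit (j : Fin m) (x : A) : G.pc j (x * ∑ l, f l) = x * f j := by
  rw [Finset.mul_sum, map_sum, Finset.sum_eq_single j, H.pc_mul_col]
  · intro k _ hk
    rw [G.pc_mul, G.pc_of_ne (H.pc_col k) hk.symm, mul_zero]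
  · simp

theorem pr_unit (i : Fin n) : G.pr i (∑ l, f l) = f' i := by
  rw [← H.isUnit.idem, H.pr_unit_mul, H.row_mul_unit]

theorem pc_unit (j : Fin m) : G.pc j (∑ l, f l) = f j := by
  rw [← H.isUnit.idem, H.pc_mul_unit, H.unit_mul_col]

variable [IsScalarTower F A A] [SMulCommClass F A A] [FiniteDimensional F A]

omit [FiniteDimensional F A] in
theorem row_mem (i : Fin n) : f' i ∈ unitSubalgebra F (∑ l, f l) :=
  ⟨H.unit_mul_row i, H.row_mul_unit i⟩

omit [FiniteDimensional F A] in
theorem col_mem (j : Fin m) : f j ∈ unitSubalgebra F (∑ l, f l) :=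
  ⟨H.unit_mul_col j, H.col_mul_unit j⟩

omit [FiniteDimensional F A] in
theorem sandwich_mem (i : Fin n) (j : Fin m) (x : A) :
    f' i * x * f j ∈ unitSubalgebra F (∑ l, f l) :=
  ⟨by rw [← mul_assoc, ← mul_assoc, H.unit_mul_row], by rw [mul_assoc, H.col_mul_unit]⟩

omit [FiniteDimensional F A] in
theorem eq_sum_sandwich {x : A} (hx : x ∈ unitSubalgebra F (∑ l, f l)) :
    x = ∑ q : Fin n × Fin m, f' q.1 * x * f q.2 := by
  have h : x = (∑ i, f' i) * x * ∑ j, f j := by rw [H.sum_eq, hx.1, hx.2]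
  conv_lhs => rw [h]
  rw [Finset.sum_mul, Finset.sum_mul_sum, ← Finset.univ_product_univ, Finset.sum_product]

variable {P : Fin m → Fin n → WithZero Unit} {𝒜 : ReesMatrixSemigroup P → Submodule F A}

theorem isGradedWedderburnMalcev (hG : G.IsSimple) (hc : G.IsCompatible 𝒜) :
    IsGradedWedderburnMalcev 𝒜 (unitSubalgebra F (∑ l, f l)) f' f where
  idem_row := H.idem_row
  orth_row := H.orth_row
  idem_col := H.idem_col
  orth_col := H.orth_col
  row_mem i := ⟨H.row_mem i, (hc.mem_rowIdeal i _).2 (H.pr_row i)⟩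
  col_mem j := ⟨H.col_mem j, (hc.mem_colIdeal j _).2 (H.pc_col j)⟩
  sum_eq := H.sum_eq
  isOne b hb := hb
  peirce := by
    refine ⟨iSupIndep_of_projections _ (fun q => sandwichMul F (f' q.1) (f q.2)) ?_ ?_, ?_⟩
    · rintro q _ ⟨x, -, rfl⟩
      change f' q.1 * (f' q.1 * x * f q.2) * f q.2 = f' q.1 * x * f q.2
      rw [mul_assoc, mul_assoc, mul_assoc, H.idem_col, ← mul_assoc, H.idem_row, mul_assoc]
    · rintro q r hqr _ ⟨x, -, rfl⟩
      change f' q.1 * (f' r.1 * x * f r.2) * f q.2 = 0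
      by_cases h1 : q.1 = r.1
      · have h2 : r.2 ≠ q.2 := fun h => hqr (Prod.ext h1.symm h)
        rw [mul_assoc, mul_assoc, H.orth_col _ _ h2]; simp
      · rw [mul_assoc, mul_assoc, ← mul_assoc, ← mul_assoc (f' q.1) (f' r.1),
          H.orth_row _ _ h1]; simp
    · apply le_antisymm
      · refine iSup_le fun q => ?_
        rintro _ ⟨x, -, rfl⟩
        exact H.sandwich_mem q.1 q.2 x
      · intro x hx
        rw [H.eq_sum_sandwich hx]
        exact Submodule.sum_mem _ fun q _ => Submodule.mem_iSup_of_mem q ⟨x, trivial, rfl⟩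
  graded := by
    refine ⟨iSupIndep_of_projections _ (fun q => G.pr q.1 ∘ₗ G.pc q.2) ?_ ?_, ?_⟩
    · rintro q x ⟨-, hx⟩
      obtain ⟨h1, h2⟩ := (hc.mem_homComp _ _ _).1 hx
      change G.pr q.1 (G.pc q.2 x) = x
      rw [h2, h1]
    · rintro q r hqr x ⟨-, hx⟩
      obtain ⟨h1, h2⟩ := (hc.mem_homComp _ _ _).1 hx
      change G.pr q.1 (G.pc q.2 x) = 0
      by_cases h3 : q.1 = r.1
      · have h4 : q.2 ≠ r.2 := fun h => hqr (Prod.ext h3.symm h.symm)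
        rw [G.pc_of_ne h2 h4, map_zero]
      · rw [G.comm, G.pr_of_ne h1 h3, map_zero]
    · apply le_antisymm
      · exact iSup_le fun q => inf_le_left
      · intro x hx
        rw [H.eq_sum_sandwich hx]
        refine Submodule.sum_mem _ fun q _ => Submodule.mem_iSup_of_mem q
          ⟨H.sandwich_mem q.1 q.2 x, (hc.mem_homComp _ _ _).2 ⟨?_, H.pc_mul_col _ _⟩⟩
        rw [mul_assoc]; exact H.pr_row_mul _ _
  maximal := hG.isMaximalSemisimple_unitSubalgebra H.isUnit
  isCompl := hG.isCompl_unitSubalgebra H.isUnit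

end RectIdempotents

namespace IsGradedWedderburnMalcev

variable [IsScalarTower F A A] [SMulCommClass F A A] [FiniteDimensional F A]
variable {G : RectGrading F A n m} {f' : Fin n → A} {f : Fin m → A}
variable {P : Fin m → Fin n → WithZero Unit} {𝒜 : ReesMatrixSemigroup P → Submodule F A}
variable {B : NonUnitalSubalgebra F A} (hB : IsGradedWedderburnMalcev 𝒜 B f' f)
include hB

/-- For b in B congruent to a modulo J(A), ae - a = (a-b)e - (a-b) lies in J(A), and likewise on the
left; so 1_B is an identity modulo the radical. -/
theorem rectIdempotents (hG : G.IsSimple) (hc : G.IsCompatible 𝒜) : RectIdempotents G f' f where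
  idem_row := hB.idem_row
  orth_row := hB.orth_row
  idem_col := hB.idem_col
  orth_col := hB.orth_col
  pr_row i := (hc.mem_rowIdeal i _).1 (hB.row_mem i).2
  pc_col j := (hc.mem_colIdeal j _).1 (hB.col_mem j).2
  sum_eq := hB.sum_eq
  isUnit := by
    have hdec : ∀ a : A, ∃ b ∈ B, a - b ∈ jacobsonRadical F A := fun a => by
      obtain ⟨b, hb, c, hc, rfl⟩ := Submodule.mem_sup.1
        (show a ∈ B.toSubmodule ⊔ jacobsonRadical F A by rw [hB.isCompl.sup_eq_top]; trivial)
      exact ⟨b, hb, by rwa [add_sub_cancel_left]⟩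
    refine ⟨sum_orthogonal_mul_sum hB.idem_col hB.orth_col, fun x a y => ?_, fun x a y => ?_⟩
    all_goals
      obtain ⟨b, hb, hJ⟩ := hdec a
      obtain ⟨h1, h2⟩ := hB.isOne b hb
    · have hm : a * (∑ l, f l) - a ∈ jacobsonRadical F A := by
        have : a * (∑ l, f l) - a = (a - b) * (∑ l, f l) - (a - b) := by
          rw [sub_mul, h2, sub_sub_sub_cancel_right]
        rw [this]
        exact sub_mem (jacobsonRadical_isTwoSided _ _ hJ).2 hJ
      have := hG.mem_jacobsonRadical_iff.1 hm x y
      rw [mul_sub, sub_mul, sub_eq_zero] at this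
      simpa only [mul_assoc] using this
    · have hm : (∑ l, f l) * a - a ∈ jacobsonRadical F A := by
        have : (∑ l, f l) * a - a = (∑ l, f l) * (a - b) - (a - b) := by
          rw [mul_sub, h1, sub_sub_sub_cancel_right]
        rw [this]
        exact sub_mem (jacobsonRadical_isTwoSided _ _ hJ).1 hJ
      have := hG.mem_jacobsonRadical_iff.1 hm x y
      rw [mul_sub, sub_mul, sub_eq_zero] at this
      simpa only [mul_assoc] using this

/-- If x = exe and x = b + c with b in B and c in J(A), then ece = 0 gives x = b. The subalgebra is
thus determined by its identity. -/
theorem eq_unitSubalgebra (hG : G.IsSimple) : B = unitSubalgebra F (∑ l, f l) := by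
  apply le_antisymm
  · exact hB.isOne
  · intro x hx
    obtain ⟨b, hb, c, hc, rfl⟩ := Submodule.mem_sup.1
      (show x ∈ B.toSubmodule ⊔ jacobsonRadical F A by rw [hB.isCompl.sup_eq_top]; trivial)
    have h0 := hG.mem_jacobsonRadical_iff.1 hc (∑ l, f l) (∑ l, f l)
    have h1 := sandwich_eq_of_mem hx
    rw [add_mul, mul_add, (hB.isOne b hb).2, (hB.isOne b hb).1, ← mul_assoc, h0, add_zero] at h1
    rw [← h1]
    exact hb

end IsGradedWedderburnMalcev

end Idempotents

/-! ### The Peirce components eA(1-e) and (1-e)Ae -/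

section PeirceComponents

variable {F : Type v} [Field F] {A : Type u} [NonUnitalRing A] [Module F A] {n m : ℕ}
variable [IsScalarTower F A A] [SMulCommClass F A A]
variable {G : RectGrading F A n m} {f' : Fin n → A} {f : Fin m → A}
variable {P : Fin m → Fin n → WithZero Unit} {𝒜 : ReesMatrixSemigroup P → Submodule F A}

namespace RectIdempotents

variable (H : RectIdempotents G f' f) (hc : G.IsCompatible 𝒜)
include H

omit [IsScalarTower F A A] [SMulCommClass F A A] in
theorem unit_mul_unit_mul (x : A) : (∑ l, f l) * ((∑ l, f l) * x) = (∑ l, f l) * x := by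
  rw [← mul_assoc, H.isUnit.idem]

omit [IsScalarTower F A A] [SMulCommClass F A A] in
theorem mul_unit_mul_unit (x : A) : x * (∑ l, f l) * (∑ l, f l) = x * (∑ l, f l) := by
  rw [mul_assoc, H.isUnit.idem]

include hc

theorem mem_J10 {i : Fin n} {j : Fin m} {w : A} : w ∈ J10 𝒜 f' f i j ↔
    ∃ x, G.pc j x = x ∧ f' i * x = x ∧ w = x - x * ∑ l, f l := by
  constructor
  · rintro ⟨x, hx, rfl⟩
    refine ⟨f' i * x, ?_, ?_, rfl⟩
    · exact G.pc_mul_of ((hc.mem_colIdeal j x).1 hx) _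
    · rw [← mul_assoc, H.idem_row]
  · rintro ⟨x, h1, h2, rfl⟩
    refine ⟨x, (hc.mem_colIdeal j x).2 h1, ?_⟩
    change f' i * x - f' i * x * _ = _
    rw [h2]

theorem mem_J01 {i : Fin n} {j : Fin m} {v : A} : v ∈ J01 𝒜 f i j ↔
    ∃ x, G.pr i x = x ∧ x * f j = x ∧ v = x - (∑ l, f l) * x := by
  constructor
  · rintro ⟨x, hx, rfl⟩
    refine ⟨x * f j, ?_, ?_, rfl⟩
    · exact G.pr_mul_of ((hc.mem_rowIdeal i x).1 hx) _
    · rw [mul_assoc, H.idem_col]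
  · rintro ⟨x, h1, h2, rfl⟩
    refine ⟨x, (hc.mem_rowIdeal i x).2 h1, ?_⟩
    change x * f j - _ * (x * f j) = _
    rw [h2]

theorem mem_J10col {j : Fin m} {w : A} : w ∈ J10col 𝒜 f' f j ↔
    ∃ x, G.pc j x = x ∧ (∑ l, f l) * x = x ∧ w = x - x * ∑ l, f l := by
  constructor
  · intro hw
    refine Submodule.iSup_induction _ (motive := fun w => ∃ x, G.pc j x = x ∧ (∑ l, f l) * x = x ∧
      w = x - x * ∑ l, f l) hw (fun i w hw => ?_) ⟨0, by simp, by simp, by simp⟩ ?_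
    · obtain ⟨x, h1, h2, rfl⟩ := (H.mem_J10 hc).1 hw
      exact ⟨x, h1, by rw [← h2, ← mul_assoc, H.unit_mul_row], rfl⟩
    · rintro _ _ ⟨x, h1, h2, rfl⟩ ⟨y, h3, h4, rfl⟩
      exact ⟨x + y, by rw [map_add, h1, h3], by rw [mul_add, h2, h4], by rw [add_mul]; abel⟩
  · rintro ⟨x, h1, h2, rfl⟩
    rw [← h2, ← H.sum_eq, Finset.sum_mul, Finset.sum_mul, ← Finset.sum_sub_distrib]
    refine Submodule.sum_mem _ fun i _ => Submodule.mem_iSup_of_mem i ((H.mem_J10 hc).2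
      ⟨f' i * x, G.pc_mul_of h1 _, by rw [← mul_assoc, H.idem_row], by rw [H.sum_eq]⟩)

theorem mem_J01row {i : Fin n} {v : A} : v ∈ J01row 𝒜 f i ↔
    ∃ x, G.pr i x = x ∧ x * (∑ l, f l) = x ∧ v = x - (∑ l, f l) * x := by
  constructor
  · intro hw
    refine Submodule.iSup_induction _ (motive := fun v => ∃ x, G.pr i x = x ∧ x * (∑ l, f l) = x ∧
      v = x - (∑ l, f l) * x) hw (fun j w hw => ?_) ⟨0, by simp, by simp, by simp⟩ ?_
    · obtain ⟨x, h1, h2, rfl⟩ := (H.mem_J01 hc).1 hw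
      exact ⟨x, h1, by rw [← h2, mul_assoc, H.col_mul_unit], rfl⟩
    · rintro _ _ ⟨x, h1, h2, rfl⟩ ⟨y, h3, h4, rfl⟩
      exact ⟨x + y, by rw [map_add, h1, h3], by rw [add_mul, h2, h4], by rw [mul_add]; abel⟩
  · rintro ⟨x, h1, h2, rfl⟩
    have h3 : x - (∑ l, f l) * x = ∑ j, (x * f j - (∑ l, f l) * (x * f j)) := by
      rw [Finset.sum_sub_distrib, ← Finset.mul_sum, ← Finset.mul_sum, ← Finset.mul_sum, h2]
    rw [h3]
    refine Submodule.sum_mem _ fun j _ => Submodule.mem_iSup_of_mem j ((H.mem_J01 hc).2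
      ⟨x * f j, G.pr_mul_of h1 _, by rw [mul_assoc, H.idem_col], rfl⟩)

theorem J10col_eq (j : Fin m) : J10col 𝒜 f' f j =
    (colIdeal 𝒜 j).map (mulOneSub F (∑ l, f l) ∘ₗ LinearMap.mulLeft F (∑ l, f l)) := by
  ext w
  rw [H.mem_J10col hc]
  constructor
  · rintro ⟨x, h1, h2, rfl⟩
    refine ⟨x, (hc.mem_colIdeal j x).2 h1, ?_⟩
    change (∑ l, f l) * x - (∑ l, f l) * x * (∑ l, f l) = _
    rw [h2]
  · rintro ⟨x, h1, rfl⟩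
    exact ⟨(∑ l, f l) * x, G.pc_mul_of ((hc.mem_colIdeal j x).1 h1) _, H.unit_mul_unit_mul x, rfl⟩

theorem J01row_eq (i : Fin n) : J01row 𝒜 f i =
    (rowIdeal 𝒜 i).map (oneSubMul F (∑ l, f l) ∘ₗ LinearMap.mulRight F (∑ l, f l)) := by
  ext w
  rw [H.mem_J01row hc]
  constructor
  · rintro ⟨x, h1, h2, rfl⟩
    refine ⟨x, (hc.mem_rowIdeal i x).2 h1, ?_⟩
    change x * (∑ l, f l) - (∑ l, f l) * (x * (∑ l, f l)) = _
    rw [h2]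
  · rintro ⟨x, h1, rfl⟩
    exact ⟨x * (∑ l, f l), G.pr_mul_of ((hc.mem_rowIdeal i x).1 h1) _, H.mul_unit_mul_unit x, rfl⟩

theorem J10col_mul_mem {j : Fin m} {b w : A} (hb : b ∈ unitSubalgebra F (∑ l, f l))
    (hw : w ∈ J10col 𝒜 f' f j) : b * w ∈ J10col 𝒜 f' f j := by
  obtain ⟨x, h1, h2, rfl⟩ := (H.mem_J10col hc).1 hw
  exact (H.mem_J10col hc).2 ⟨b * x, G.pc_mul_of h1 _, by rw [← mul_assoc, hb.1],
    by rw [mul_sub, mul_assoc]⟩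

theorem J01row_mul_mem {i : Fin n} {b v : A} (hb : b ∈ unitSubalgebra F (∑ l, f l))
    (hv : v ∈ J01row 𝒜 f i) : v * b ∈ J01row 𝒜 f i := by
  obtain ⟨x, h1, h2, rfl⟩ := (H.mem_J01row hc).1 hv
  exact (H.mem_J01row hc).2 ⟨x * b, G.pr_mul_of h1 _, by rw [mul_assoc, hb.2],
    by rw [sub_mul, mul_assoc]⟩

theorem isDirectSum_J10 (j : Fin m) :
    IsDirectSum (fun i => J10 𝒜 f' f i j) (J10col 𝒜 f' f j) := by
  refine ⟨iSupIndep_of_projections _ (fun i => LinearMap.mulLeft F (f' i)) ?_ ?_, rfl⟩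
  · intro i w hw
    obtain ⟨x, h1, h2, rfl⟩ := (H.mem_J10 hc).1 hw
    rw [LinearMap.mulLeft_apply, mul_sub, ← mul_assoc, h2]
  · intro i k hik w hw
    obtain ⟨x, h1, h2, rfl⟩ := (H.mem_J10 hc).1 hw
    rw [LinearMap.mulLeft_apply, ← h2]
    simp only [mul_sub, ← mul_assoc, H.orth_row i k hik.symm]
    simp

theorem isDirectSum_J01 (i : Fin n) :
    IsDirectSum (fun j => J01 𝒜 f i j) (J01row 𝒜 f i) := by
  refine ⟨iSupIndep_of_projections _ (fun i => LinearMap.mulRight F (f i)) ?_ ?_, rfl⟩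
  · intro i w hw
    obtain ⟨x, h1, h2, rfl⟩ := (H.mem_J01 hc).1 hw
    rw [LinearMap.mulRight_apply, sub_mul, mul_assoc, h2]
  · intro i k hik w hw
    obtain ⟨x, h1, h2, rfl⟩ := (H.mem_J01 hc).1 hw
    rw [LinearMap.mulRight_apply, ← h2]
    simp only [sub_mul, mul_assoc, H.orth_col k i hik]
    simp

/-- The sum over all columns is the full Peirce component eA(1-e): its elements w satisfy w = ∑
pc_j(w)(1-e), since we = 0, and left multiplication by e commutes with pc_j. -/
theorem mem_iSup_J10col {w : A} : w ∈ (⨆ j, J10col 𝒜 f' f j) ↔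
    (∑ l, f l) * w = w ∧ w * (∑ l, f l) = 0 := by
  constructor
  · intro hw
    refine Submodule.iSup_induction _ (motive := fun w => (∑ l, f l) * w = w ∧
      w * (∑ l, f l) = 0) hw (fun j w hw => ?_) (by simp) ?_
    · obtain ⟨x, h1, h2, rfl⟩ := (H.mem_J10col hc).1 hw
      refine ⟨by rw [mul_sub, ← mul_assoc, h2], ?_⟩
      rw [sub_mul, H.mul_unit_mul_unit, sub_self]
    · rintro x y ⟨h1, h2⟩ ⟨h3, h4⟩
      exact ⟨by rw [mul_add, h1, h3], by rw [add_mul, h2, h4, add_zero]⟩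
  · rintro ⟨h1, h2⟩
    have h3 : w = ∑ j, (G.pc j w - G.pc j w * ∑ l, f l) := by
      rw [Finset.sum_sub_distrib, ← Finset.sum_mul, G.sum_pc, h2, sub_zero]
    rw [h3]
    exact Submodule.sum_mem _ fun j _ => Submodule.mem_iSup_of_mem j ((H.mem_J10col hc).2
      ⟨_, G.pc_self j w, by rw [← G.pc_mul, h1], rfl⟩)

theorem mem_iSup_J01row {v : A} : v ∈ (⨆ i, J01row 𝒜 f i) ↔
    v * (∑ l, f l) = v ∧ (∑ l, f l) * v = 0 := by
  constructor
  · intro hw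
    refine Submodule.iSup_induction _ (motive := fun v => v * (∑ l, f l) = v ∧
      (∑ l, f l) * v = 0) hw (fun j w hw => ?_) (by simp) ?_
    · obtain ⟨x, h1, h2, rfl⟩ := (H.mem_J01row hc).1 hw
      refine ⟨by rw [sub_mul, mul_assoc, h2], ?_⟩
      rw [mul_sub, H.unit_mul_unit_mul, sub_self]
    · rintro x y ⟨h1, h2⟩ ⟨h3, h4⟩
      exact ⟨by rw [add_mul, h1, h3], by rw [mul_add, h2, h4, add_zero]⟩
  · rintro ⟨h1, h2⟩
    have h3 : v = ∑ i, (G.pr i v - (∑ l, f l) * G.pr i v) := by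
      rw [Finset.sum_sub_distrib, ← Finset.mul_sum, G.sum_pr, h2, sub_zero]
    rw [h3]
    exact Submodule.sum_mem _ fun j _ => Submodule.mem_iSup_of_mem j ((H.mem_J01row hc).2
      ⟨_, G.pr_self j v, by rw [← G.pr_mul, h1], rfl⟩)

/-- Write w_j = x_j(1-e) with x_j in L_j. If ∑ w_j = 0 then X = ∑ x_j equals Xe, and its column
component is x_k = pc_k(Xe) = Xf_k, which 1-e kills. -/
theorem iSupIndep_J10col : iSupIndep (fun j => J10col 𝒜 f' f j) := by
  refine iSupIndep_of_sum_eq_zero _ fun w hw h0 k => ?_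
  choose x h1 h2 h3 using fun j => (H.mem_J10col hc).1 (hw j)
  have h4 : ∑ j, x j = (∑ j, x j) * ∑ l, f l := by
    rw [← sub_eq_zero, ← h0, Finset.sum_mul, ← Finset.sum_sub_distrib]
    exact Finset.sum_congr rfl fun j _ => (h3 j).symm
  have h5 : G.pc k (∑ j, x j) = x k := by
    rw [map_sum, Finset.sum_eq_single k, h1]
    · intro j _ hj; exact G.pc_of_ne (h1 j) hj.symm
    · simp
  rw [h4, H.pc_mul_unit] at h5
  rw [h3, ← h5, mul_assoc, H.col_mul_unit, sub_self]

theorem iSupIndep_J01row : iSupIndep (fun i => J01row 𝒜 f i) := by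
  refine iSupIndep_of_sum_eq_zero _ fun w hw h0 k => ?_
  choose x h1 h2 h3 using fun j => (H.mem_J01row hc).1 (hw j)
  have h4 : ∑ j, x j = (∑ l, f l) * (∑ j, x j) := by
    rw [← sub_eq_zero, ← h0, Finset.mul_sum, ← Finset.sum_sub_distrib]
    exact Finset.sum_congr rfl fun j _ => (h3 j).symm
  have h5 : G.pr k (∑ j, x j) = x k := by
    rw [map_sum, Finset.sum_eq_single k, h1]
    · intro j _ hj; exact G.pr_of_ne (h1 j) hj.symm
    · simp
  rw [h4, H.pr_unit_mul] at h5
  rw [h3, ← h5, ← mul_assoc, H.unit_mul_row, sub_self]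

end RectIdempotents

end PeirceComponents

/-! ### The decompositions of J(A) and its square -/

section RadicalDecomposition

variable {F : Type v} [Field F] {A : Type u} [NonUnitalRing A] [Module F A] {n m : ℕ}
variable {G : RectGrading F A n m} {f' : Fin n → A} {f : Fin m → A}
variable {P : Fin m → Fin n → WithZero Unit} {𝒜 : ReesMatrixSemigroup P → Submodule F A}

theorem mul_mem_subspaceMul {M N : Submodule F A} {x y : A} (hx : x ∈ M) (hy : y ∈ N) :
    x * y ∈ subspaceMul M N := Submodule.subset_span ⟨x, hx, y, hy, rfl⟩

theorem subspaceMul_mono {M M' N N' : Submodule F A} (h : M ≤ M') (h' : N ≤ N') :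
    subspaceMul M N ≤ subspaceMul M' N' :=
  Submodule.span_mono fun _ ⟨x, hx, y, hy, hz⟩ => ⟨x, h hx, y, h' hy, hz⟩

variable [IsScalarTower F A A] [SMulCommClass F A A]

/-- An induction principle based on `A = A³`. -/
theorem RectGrading.IsSimple.triple_induction (hG : G.IsSimple) {p : A → Prop} (zero : p 0)
    (add : ∀ x y, p x → p y → p (x + y)) (smul : ∀ (c : F) x, p x → p (c • x))
    (mul_mul : ∀ x a y, p (x * (a * y))) (x : A) : p x := by
  have hx : x ∈ Submodule.span F {z : A | ∃ x a y, z = x * a * y} := by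
    rw [hG.triple_span]; trivial
  induction hx using Submodule.span_induction with
  | mem x h => obtain ⟨x, a, y, rfl⟩ := h; rw [mul_assoc]; exact mul_mul x a y
  | zero => exact zero
  | add x y _ _ hx hy => exact add _ _ hx hy
  | smul c x _ hx => exact smul _ _ hx

namespace RectIdempotents

variable [FiniteDimensional F A] (H : RectIdempotents G f' f) (hG : G.IsSimple)
  (hc : G.IsCompatible 𝒜)
include H hG

theorem mem_radical_iff {a : A} :
    a ∈ jacobsonRadical F A ↔ (∑ l, f l) * (a * (∑ l, f l)) = 0 := by
  rw [hG.mem_jacobsonRadical_iff]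
  constructor
  · intro h; rw [← mul_assoc]; exact h _ _
  · intro h x y
    have : x * a * y = x * ((∑ l, f l) * (a * (∑ l, f l))) * y := by
      simp only [mul_assoc, H.isUnit.mul_mul, H.isUnit.mul_mul']
    rw [this, h]; simp

include hc

theorem J10col_le (j : Fin m) : J10col 𝒜 f' f j ≤ jacobsonRadical F A := by
  intro w hw
  have := (H.mem_iSup_J10col hc).1 (Submodule.mem_iSup_of_mem j hw)
  rw [H.mem_radical_iff hG, this.2, mul_zero]

theorem J01row_le (i : Fin n) : J01row 𝒜 f i ≤ jacobsonRadical F A := by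
  intro w hw
  have := (H.mem_iSup_J01row hc).1 (Submodule.mem_iSup_of_mem i hw)
  rw [H.mem_radical_iff hG, this.1, this.2]

omit [FiniteDimensional F A] in
/-- `J⁰¹_{i*} J¹⁰_{*j} = (1 - e) A_{ij} (1 - e)`. -/
theorem mem_subspaceMul_iff {i : Fin n} {j : Fin m} {z : A} :
    z ∈ subspaceMul (J01row 𝒜 f i) (J10col 𝒜 f' f j) ↔ ∃ a, G.pr i a = a ∧ G.pc j a = a ∧
      z = a - (∑ l, f l) * a - a * (∑ l, f l) + (∑ l, f l) * (a * ∑ l, f l) := by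
  constructor
  · intro hz
    induction hz using Submodule.span_induction with
    | mem z h =>
      obtain ⟨v, hv, w, hw, rfl⟩ := h
      obtain ⟨x, h1, h2, rfl⟩ := (H.mem_J01row hc).1 hv
      obtain ⟨y, h3, h4, rfl⟩ := (H.mem_J10col hc).1 hw
      exact ⟨x * y, G.pr_mul_of h1 _, G.pc_mul_of h3 _, by noncomm_ring⟩
    | zero => exact ⟨0, by simp⟩
    | add z z' _ _ h h' =>
      obtain ⟨a, h1, h2, rfl⟩ := h
      obtain ⟨b, h3, h4, rfl⟩ := h'
      exact ⟨a + b, by rw [map_add, h1, h3], by rw [map_add, h2, h4], by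
        simp only [mul_add, add_mul]; abel⟩
    | smul c z _ h =>
      obtain ⟨a, h1, h2, rfl⟩ := h
      exact ⟨c • a, by rw [map_smul, h1], by rw [map_smul, h2], by
        simp only [smul_sub, smul_add, mul_smul_comm, smul_mul_assoc]⟩
  · rintro ⟨a, h1, h2, rfl⟩
    rw [← h1, ← h2]
    clear h1 h2
    induction a using hG.triple_induction with
    | zero => simp
    | add a b ha hb =>
      refine Eq.mp (congrArg (· ∈ _) ?_) (add_mem ha hb)
      simp only [map_add, mul_add, add_mul]; abel
    | smul c a ha =>
      refine Eq.mp (congrArg (· ∈ _) ?_) (Submodule.smul_mem _ c ha)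
      simp only [map_smul, smul_sub, smul_add, mul_smul_comm, smul_mul_assoc]
    -- Here pr_i pc_j(xay) = pr_i(x) a pc_j(y). Inserting e·e after pr_i(x) does not change the
    -- product, and one e goes to each factor to make them xe-type and ey-type.
    | mul_mul x a y =>
      refine Eq.mp (congrArg (· ∈ _) ?_) (mul_mem_subspaceMul
        ((H.mem_J01row hc).2 ⟨G.pr i x * ∑ l, f l, G.pr_mul_of (G.pr_self i x) _,
          H.mul_unit_mul_unit _, rfl⟩)
        ((H.mem_J10col hc).2 ⟨(∑ l, f l) * (a * G.pc j y),
          G.pc_mul_of (G.pc_mul_of (G.pc_self j y) _) _, H.unit_mul_unit_mul _, rfl⟩))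
      rw [G.pc_mul, G.pc_mul, G.pr_mul]
      simp only [sub_mul, mul_sub, mul_assoc, H.isUnit.mul_mul']
      abel

/-- `J(A)² = (1 - e) A (1 - e)`. -/
theorem mem_sq_radical_iff {a : A} :
    a ∈ subspaceMul (jacobsonRadical F A) (jacobsonRadical F A) ↔
      (∑ l, f l) * a = 0 ∧ a * (∑ l, f l) = 0 := by
  constructor
  · intro ha
    induction ha using Submodule.span_induction with
    | mem z h =>
      obtain ⟨v, hv, w, hw, rfl⟩ := h
      rw [hG.mem_jacobsonRadical_iff] at hv hw
      exact ⟨by rw [← mul_assoc]; exact hv _ _, hw _ _⟩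
    | zero => simp
    | add x y _ _ hx hy =>
      exact ⟨by rw [mul_add, hx.1, hy.1, add_zero], by rw [add_mul, hx.2, hy.2, add_zero]⟩
    | smul c x _ hx =>
      exact ⟨by rw [mul_smul_comm, hx.1, smul_zero], by rw [smul_mul_assoc, hx.2, smul_zero]⟩
  · rintro ⟨h1, h2⟩
    have h3 : a = ∑ i, ∑ j, (G.pr i (G.pc j a) - (∑ l, f l) * G.pr i (G.pc j a)
        - G.pr i (G.pc j a) * (∑ l, f l) + (∑ l, f l) * (G.pr i (G.pc j a) * ∑ l, f l)) := by
      simp only [Finset.sum_add_distrib, Finset.sum_sub_distrib, ← Finset.mul_sum, ← Finset.sum_mul,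
        G.sum_sum, h1, h2]
      simp
    rw [h3]
    refine Submodule.sum_mem _ fun i _ => Submodule.sum_mem _ fun j _ => ?_
    refine subspaceMul_mono (H.J01row_le hG hc i) (H.J10col_le hG hc j)
      ((H.mem_subspaceMul_iff hG hc).2 ⟨G.pr i (G.pc j a), G.pr_self _ _, ?_, rfl⟩)
    rw [← G.comm, G.pc_self]

theorem isDirectSum_sq_radical : IsDirectSum
    (fun p : Fin n × Fin m => subspaceMul (J01row 𝒜 f p.1) (J10col 𝒜 f' f p.2))
    (subspaceMul (jacobsonRadical F A) (jacobsonRadical F A)) := by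
  constructor
  · refine iSupIndep_of_sum_eq_zero _ fun z hz h0 q => ?_
    choose a h1 h2 h3 using fun p => (H.mem_subspaceMul_iff hG hc).1 (hz p)
    have h4 : ∑ p, a p = (∑ l, f l) * (∑ p, a p) + (∑ p, a p) * (∑ l, f l)
        - (∑ l, f l) * ((∑ p, a p) * ∑ l, f l) := by
      rw [← sub_eq_zero, ← h0]
      simp only [h3, Finset.sum_add_distrib, Finset.sum_sub_distrib, ← Finset.mul_sum,
        ← Finset.sum_mul]
      abel
    have h5 : G.pr q.1 (G.pc q.2 (∑ p, a p)) = a q := by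
      rw [map_sum, map_sum, Finset.sum_eq_single q, h2, h1]
      · intro p _ hp
        by_cases h6 : q.1 = p.1
        · have h7 : q.2 ≠ p.2 := fun h => hp (Prod.ext h6.symm h.symm)
          rw [G.pc_of_ne (h2 p) h7, map_zero]
        · rw [G.comm, G.pr_of_ne (h1 p) h6, map_zero]
      · simp
    -- Taking the component of bidegree q in S = eS + Se - eSe replaces outer factors e by f'_i and
    -- f_j. Each resulting term begins with f'_i or ends with f_j, so it is killed by 1-e on that
    -- side.
    have h6 : a q = f' q.1 * G.pc q.2 (∑ p, a p) + G.pr q.1 (∑ p, a p) * f q.2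
        - f' q.1 * ((∑ p, a p) * f q.2) := by
      rw [← h5]
      conv_lhs => rw [h4]
      simp only [map_add, map_sub, G.pc_mul, G.pr_mul, H.pc_unit, H.pr_unit]
    rw [h3, h6]
    simp only [mul_add, add_mul, mul_sub, sub_mul, ← mul_assoc, H.unit_mul_row]
    simp only [mul_assoc, H.col_mul_unit]
    abel
  · apply le_antisymm
    · exact iSup_le fun p => subspaceMul_mono (H.J01row_le hG hc p.1) (H.J10col_le hG hc p.2)
    · intro a ha
      obtain ⟨h1, h2⟩ := (H.mem_sq_radical_iff hG hc).1 ha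
      have h3 : a = ∑ i, ∑ j, (G.pr i (G.pc j a) - (∑ l, f l) * G.pr i (G.pc j a)
          - G.pr i (G.pc j a) * (∑ l, f l) + (∑ l, f l) * (G.pr i (G.pc j a) * ∑ l, f l)) := by
        simp only [Finset.sum_add_distrib, Finset.sum_sub_distrib, ← Finset.mul_sum,
          ← Finset.sum_mul, G.sum_sum, h1, h2]
        simp
      rw [h3]
      refine Submodule.sum_mem _ fun i _ => Submodule.sum_mem _ fun j _ => ?_
      refine Submodule.mem_iSup_of_mem (i, j)
        ((H.mem_subspaceMul_iff hG hc).2 ⟨G.pr i (G.pc j a), G.pr_self _ _, ?_, rfl⟩)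
      rw [← G.comm, G.pc_self]

theorem isDirectSum_radical : IsDirectSum
    (Sum.elim (fun i => J01row 𝒜 f i) (Sum.elim (fun j => J10col 𝒜 f' f j)
      (fun _ : Unit => subspaceMul (jacobsonRadical F A) (jacobsonRadical F A))))
    (jacobsonRadical F A) := by
  constructor
  · refine iSupIndep_of_sum_eq_zero _ fun z hz h0 => ?_
    have hz1 : ∀ i, z (Sum.inl i) ∈ J01row 𝒜 f i := fun i => hz (Sum.inl i)
    have hz2 : ∀ j, z (Sum.inr (Sum.inl j)) ∈ J10col 𝒜 f' f j := fun j => hz (Sum.inr (Sum.inl j))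
    have hz3 := (H.mem_sq_radical_iff hG hc).1 (hz (Sum.inr (Sum.inr ())))
    have hV := (H.mem_iSup_J01row hc).1
      (Submodule.sum_mem _ fun i (_ : i ∈ Finset.univ) => Submodule.mem_iSup_of_mem i (hz1 i))
    have hW := (H.mem_iSup_J10col hc).1
      (Submodule.sum_mem _ fun i (_ : i ∈ Finset.univ) => Submodule.mem_iSup_of_mem i (hz2 i))
    rw [Fintype.sum_sum_type, Fintype.sum_sum_type] at h0
    simp only [Finset.univ_unique, Finset.sum_singleton] at h0
    have hV0 : ∑ i, z (Sum.inl i) = 0 := by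
      have := congrArg (· * ∑ l, f l) h0
      simpa only [add_mul, hV.1, hW.2, hz3.2, add_zero, zero_mul] using this
    have hW0 : ∑ i, z (Sum.inr (Sum.inl i)) = 0 := by
      have := congrArg ((∑ l, f l) * ·) h0
      simpa only [mul_add, hV.2, hW.1, hz3.1, add_zero, zero_add, mul_zero] using this
    rintro (i | j | u)
    · exact (H.iSupIndep_J01row hc).sum_eq_zero (fun i => z (Sum.inl i)) hz1 hV0 i
    · exact (H.iSupIndep_J10col hc).sum_eq_zero (fun j => z (Sum.inr (Sum.inl j))) hz2 hW0 j
    · rw [hV0, hW0, zero_add, zero_add] at h0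
      exact h0
  · apply le_antisymm
    · refine iSup_le ?_
      rintro (i | j | u)
      · exact H.J01row_le hG hc i
      · exact H.J10col_le hG hc j
      · refine Submodule.span_le.2 ?_
        rintro _ ⟨x, hx, y, -, rfl⟩
        exact (jacobsonRadical_isTwoSided _ _ hx).2
    · intro a ha
      have h0 := (H.mem_radical_iff hG).1 ha
      have h1 : a * (∑ l, f l) ∈ ⨆ i, J01row 𝒜 f i :=
        (H.mem_iSup_J01row hc).2 ⟨H.mul_unit_mul_unit a, h0⟩
      have h2 : (∑ l, f l) * a ∈ ⨆ i, J10col 𝒜 f' f i :=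
        (H.mem_iSup_J10col hc).2 ⟨H.unit_mul_unit_mul a, by rw [mul_assoc, h0]⟩
      have h3 : a - a * (∑ l, f l) - (∑ l, f l) * a ∈
          subspaceMul (jacobsonRadical F A) (jacobsonRadical F A) := by
        refine (H.mem_sq_radical_iff hG hc).2 ⟨?_, ?_⟩
        · rw [mul_sub, mul_sub, h0, H.unit_mul_unit_mul]; simp
        · rw [sub_mul, sub_mul, mul_assoc _ a, h0, H.mul_unit_mul_unit]; simp
      -- The Peirce decomposition of a, whose eae part vanishes because a is in the radical.
      have h4 : a = a * (∑ l, f l) + ((∑ l, f l) * a +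
          (a - a * (∑ l, f l) - (∑ l, f l) * a)) := by abel
      rw [h4, iSup_sum, iSup_sum]
      exact Submodule.add_mem_sup h1 (Submodule.add_mem_sup h2 (Submodule.mem_iSup_of_mem () h3))

end RectIdempotents

end RadicalDecomposition

/-! ### Construction and properties of φ -/

section PhiMap

variable {F : Type v} [Field F] {A : Type u} [NonUnitalRing A] [Module F A] {n m : ℕ}
variable [IsScalarTower F A A] [SMulCommClass F A A]

/-- The map `u ↦ ∑ⱼ pⱼ(e u) (e - fⱼ) + ∑ᵢ (e - f'ᵢ) qᵢ(u e)` with `e = ∑ⱼ fⱼ`. -/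
def phiMap (G : RectGrading F A n m) (f' : Fin n → A) (f : Fin m → A) : A →ₗ[F] A :=
  ∑ j, LinearMap.mulRight F (∑ l, f l - f j) ∘ₗ G.pc j ∘ₗ LinearMap.mulLeft F (∑ l, f l) +
  ∑ i, LinearMap.mulLeft F (∑ l, f l - f' i) ∘ₗ G.pr i ∘ₗ LinearMap.mulRight F (∑ l, f l)

variable {G : RectGrading F A n m} {f' : Fin n → A} {f : Fin m → A}
variable {P : Fin m → Fin n → WithZero Unit} {𝒜 : ReesMatrixSemigroup P → Submodule F A}

theorem phiMap_apply (u : A) : phiMap G f' f u =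
    ∑ j, G.pc j ((∑ l, f l) * u) * (∑ l, f l - f j) +
      ∑ i, (∑ l, f l - f' i) * G.pr i (u * ∑ l, f l) := by
  simp only [phiMap, LinearMap.add_apply, LinearMap.sum_apply, LinearMap.comp_apply,
    LinearMap.mulRight_apply, LinearMap.mulLeft_apply]

namespace RectIdempotents

variable (H : RectIdempotents G f' f) (hc : G.IsCompatible 𝒜)
include H

theorem phiMap_mem (u : A) : phiMap G f' f u ∈ unitSubalgebra F (∑ l, f l) := by
  rw [phiMap_apply]
  refine add_mem (sum_mem fun j _ => ⟨?_, ?_⟩) (sum_mem fun i _ => ⟨?_, ?_⟩)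
  · rw [G.pc_mul, ← mul_assoc, H.unit_mul_unit_mul]
  · rw [mul_assoc, sub_mul, H.isUnit.idem, H.col_mul_unit]
  · rw [← mul_assoc, mul_sub, H.isUnit.idem, H.unit_mul_row]
  · rw [G.pr_mul, mul_assoc, H.mul_unit_mul_unit]

/-- The value depends only on v = x - xe, although x is not unique: pc_j(v) = x - xf_j, and its
product with e - f_j is xe - xf_j. For k ≠ j, pc_k(v) = -xf_k is killed by e - f_k. -/
theorem phiMap_col {j : Fin m} {x : A} (h1 : G.pc j x = x) (h2 : (∑ l, f l) * x = x) :
    phiMap G f' f (x - x * ∑ l, f l) = x * (∑ l, f l) - x * f j := by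
  rw [phiMap_apply, sub_mul, H.mul_unit_mul_unit, sub_self]
  simp only [map_zero, mul_zero, Finset.sum_const_zero, add_zero]
  have h3 : (∑ l, f l) * (x - x * ∑ l, f l) = x - x * ∑ l, f l := by
    rw [mul_sub, ← mul_assoc, h2]
  rw [h3, Finset.sum_eq_single j]
  · rw [map_sub, h1, H.pc_mul_unit, sub_mul, mul_assoc, mul_sub, mul_sub, H.col_mul_unit,
      H.idem_col, sub_self, mul_zero, sub_zero]
  · intro k _ hk
    rw [map_sub, G.pc_of_ne h1 hk, H.pc_mul_unit, zero_sub, neg_mul, mul_assoc, mul_sub,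
      H.col_mul_unit, H.idem_col, sub_self, mul_zero, neg_zero]
  · simp

theorem phiMap_row {i : Fin n} {x : A} (h1 : G.pr i x = x) (h2 : x * (∑ l, f l) = x) :
    phiMap G f' f (x - (∑ l, f l) * x) = (∑ l, f l) * x - f' i * x := by
  rw [phiMap_apply, mul_sub, H.unit_mul_unit_mul, sub_self]
  simp only [map_zero, zero_mul, Finset.sum_const_zero, zero_add]
  have h3 : (x - (∑ l, f l) * x) * (∑ l, f l) = x - (∑ l, f l) * x := by
    rw [sub_mul, mul_assoc, h2]
  rw [h3, Finset.sum_eq_single i]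
  · rw [map_sub, h1, H.pr_unit_mul, mul_sub, ← mul_assoc, sub_mul, sub_mul, H.unit_mul_row,
      H.idem_row, sub_self, zero_mul, sub_zero]
  · intro k _ hk
    rw [map_sub, G.pr_of_ne h1 hk, H.pr_unit_mul, zero_sub, mul_neg, ← mul_assoc, sub_mul,
      H.unit_mul_row, H.idem_row, sub_self, zero_mul, neg_zero]
  · simp

/-- The corestriction of `phiMap` to the subalgebra. -/
def phi (𝒜 : ReesMatrixSemigroup P → Submodule F A) :
    phiDomain 𝒜 f' f →ₗ[F] unitSubalgebra F (∑ l, f l) where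
  toFun u := ⟨phiMap G f' f u, H.phiMap_mem u⟩
  map_add' u v := Subtype.ext (map_add (phiMap G f' f) (u : A) v)
  map_smul' c u := Subtype.ext (map_smul (phiMap G f' f) c (u : A))

theorem phi_apply (u : phiDomain 𝒜 f' f) : (H.phi 𝒜 u : A) = phiMap G f' f u := rfl

omit [IsScalarTower F A A] [SMulCommClass F A A] in
theorem eq_sandwich {i : Fin n} {x : A} (h : f' i * x = x) : (∑ l, f l) * x = x := by
  rw [← h, ← mul_assoc, H.unit_mul_row]

omit [IsScalarTower F A A] [SMulCommClass F A A] in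
theorem eq_sandwich' {j : Fin m} {x : A} (h : x * f j = x) : x * (∑ l, f l) = x := by
  rw [← h, mul_assoc, H.col_mul_unit]

include hc

theorem col_mem_phiDomain {j : Fin m} {x : A} (h1 : G.pc j x = x) (h2 : (∑ l, f l) * x = x) :
    x - x * (∑ l, f l) ∈ phiDomain 𝒜 f' f :=
  Submodule.mem_sup_right (Submodule.mem_iSup_of_mem j ((H.mem_J10col hc).2 ⟨x, h1, h2, rfl⟩))

theorem row_mem_phiDomain {i : Fin n} {x : A} (h1 : G.pr i x = x) (h2 : x * (∑ l, f l) = x) :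
    x - (∑ l, f l) * x ∈ phiDomain 𝒜 f' f :=
  Submodule.mem_sup_left (Submodule.mem_iSup_of_mem i ((H.mem_J01row hc).2 ⟨x, h1, h2, rfl⟩))

theorem isPhi_phi : IsPhi (H.phi 𝒜) := by
  intro i j a ha
  obtain ⟨_, ⟨x, hx, rfl⟩, _, ⟨y, hy, rfl⟩, rfl⟩ := Submodule.mem_sup.1 ha
  obtain ⟨hx1, hx2⟩ := (hc.mem_homComp i j x).1 hx
  obtain ⟨hy1, hy2⟩ := (hc.mem_homComp i j y).1 hy
  simp only [LinearMap.mulLeft_apply, LinearMap.mulRight_apply]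
  have hX1 : G.pc j (f' i * x) = f' i * x := G.pc_mul_of hx2 _
  have hX2 : (∑ l, f l) * (f' i * x) = f' i * x := by rw [← mul_assoc, H.unit_mul_row]
  have hY1 : G.pr i (y * f j) = y * f j := G.pr_mul_of hy1 _
  have hY2 : y * f j * (∑ l, f l) = y * f j := by rw [mul_assoc, H.col_mul_unit]
  have key : f' i * x + y * f j - (∑ l, f l) * (f' i * x + y * f j) * (∑ l, f l) =
      (f' i * x - f' i * x * ∑ l, f l) + (y * f j - (∑ l, f l) * (y * f j)) := by
    rw [mul_add, hX2, add_mul, mul_assoc _ (y * f j), hY2]; abel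
  have hmem : f' i * x + y * f j - (∑ l, f l) * (f' i * x + y * f j) * (∑ l, f l) ∈
      phiDomain 𝒜 f' f := by
    rw [key]
    exact add_mem (H.col_mem_phiDomain hc hX1 hX2) (H.row_mem_phiDomain hc hY1 hY2)
  refine ⟨hmem, ?_⟩
  rw [H.phi_apply]
  change phiMap G f' f (f' i * x + y * f j - (∑ l, f l) * (f' i * x + y * f j) * (∑ l, f l)) = _
  rw [key, map_add, H.phiMap_col hX1 hX2, H.phiMap_row hY1 hY2, mul_add, hX2, add_mul,
    mul_assoc (∑ l, f l) (y * f j), hY2, mul_add, add_mul, ← mul_assoc (f' i) (f' i), H.idem_row,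
    mul_assoc (f' i) (y * f j), mul_assoc y, H.idem_col]
  abel

/-- An x in L_j with f'_i x = x already lies in A_ij, so the prescribed formula covers every element
of each J¹⁰_ij; likewise for each J⁰¹_ij. These span the domain. -/
theorem eq_of_isPhi {φ ψ : phiDomain 𝒜 f' f →ₗ[F] unitSubalgebra F (∑ l, f l)}
    (hφ : IsPhi φ) (hψ : IsPhi ψ) : φ = ψ := by
  let K : Submodule F A := (LinearMap.eqLocus φ ψ).map (phiDomain 𝒜 f' f).subtype
  have hK : ∀ (i : Fin n) (j : Fin m) (a : A),
      a ∈ (homComp 𝒜 i j).map (LinearMap.mulLeft F (f' i)) ⊔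
        (homComp 𝒜 i j).map (LinearMap.mulRight F (f j)) →
      a - (∑ l, f l) * a * (∑ l, f l) ∈ K := by
    intro i j a ha
    obtain ⟨h, h1⟩ := hφ i j a ha
    obtain ⟨_, h2⟩ := hψ i j a ha
    exact ⟨⟨_, h⟩, Subtype.ext (h1.trans h2.symm), rfl⟩
  have hle : phiDomain 𝒜 f' f ≤ K := by
    refine sup_le (iSup_le fun i => iSup_le fun j => ?_) (iSup_le fun j => iSup_le fun i => ?_)
    · intro v hv
      obtain ⟨x, h1, h2, rfl⟩ := (H.mem_J01 hc).1 hv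
      have := hK i j x (Submodule.mem_sup_right
        ⟨x, (hc.mem_homComp i j x).2 ⟨h1, by rw [← h2]; exact H.pc_mul_col j x⟩, h2⟩)
      rwa [mul_assoc, H.eq_sandwich' h2] at this
    · intro v hv
      obtain ⟨x, h1, h2, rfl⟩ := (H.mem_J10 hc).1 hv
      have := hK i j x (Submodule.mem_sup_left
        ⟨x, (hc.mem_homComp i j x).2 ⟨by rw [← h2]; exact H.pr_row_mul i x, h1⟩, h2⟩)
      rwa [H.eq_sandwich h2] at this
  ext u
  obtain ⟨u', hu', h⟩ := hle u.2
  have h3 : u' = u := Subtype.ext h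
  subst h3
  exact congrArg Subtype.val hu'

theorem phiMap_mul_left {b w : A} (hb : b ∈ unitSubalgebra F (∑ l, f l))
    (hw : w ∈ ⨆ j, J10col 𝒜 f' f j) : phiMap G f' f (b * w) = b * phiMap G f' f w := by
  obtain ⟨h1, h2⟩ := (H.mem_iSup_J10col hc).1 hw
  rw [phiMap_apply, phiMap_apply, mul_assoc b, h2, ← mul_assoc, hb.1, h1]
  simp only [mul_zero, map_zero, Finset.sum_const_zero, add_zero, G.pc_mul, mul_assoc,
    Finset.mul_sum]

theorem phiMap_mul_right {b v : A} (hb : b ∈ unitSubalgebra F (∑ l, f l))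
    (hv : v ∈ ⨆ i, J01row 𝒜 f i) : phiMap G f' f (v * b) = phiMap G f' f v * b := by
  obtain ⟨h1, h2⟩ := (H.mem_iSup_J01row hc).1 hv
  rw [phiMap_apply, phiMap_apply, ← mul_assoc _ v, h2, mul_assoc, hb.2, h1]
  simp only [zero_mul, map_zero, Finset.sum_const_zero, zero_add, G.pr_mul, ← mul_assoc,
    Finset.sum_mul]

variable (hG : G.IsSimple)
include hG

/-- If φ(x - xe) = 0, then z = x - xf_j satisfies ez = z and ze = 0. Since zy = e z y = e z e y,
also zA = 0. As z lies in L_j, z = 0; then x = xf_j and x - xe = 0. -/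
theorem eq_zero_of_phiMap_col {j : Fin m} {w : A} (hw : w ∈ J10col 𝒜 f' f j)
    (h : phiMap G f' f w = 0) : w = 0 := by
  obtain ⟨x, h1, h2, rfl⟩ := (H.mem_J10col hc).1 hw
  rw [H.phiMap_col h1 h2] at h
  have h3 : x - x * f j = 0 := by
    refine hG.eq_zero_of_col (j := j) (by rw [map_sub, h1, H.pc_mul_col]) fun y => ?_
    have h4 : (x - x * f j) * ∑ l, f l = 0 := by rw [sub_mul, mul_assoc, H.col_mul_unit, h]
    have h5 : (∑ l, f l) * (x - x * f j) = x - x * f j := by rw [mul_sub, ← mul_assoc, h2]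
    rw [← h5, mul_assoc, ← H.isUnit.mul_mul, ← mul_assoc _ _ y, h4]
    simp
  rw [sub_eq_zero.1 h3, mul_assoc, H.col_mul_unit, sub_self]

theorem eq_zero_of_phiMap_row {i : Fin n} {v : A} (hv : v ∈ J01row 𝒜 f i)
    (h : phiMap G f' f v = 0) : v = 0 := by
  obtain ⟨x, h1, h2, rfl⟩ := (H.mem_J01row hc).1 hv
  rw [H.phiMap_row h1 h2] at h
  have h3 : x - f' i * x = 0 := by
    refine hG.eq_zero_of_row (i := i) (by rw [map_sub, h1, H.pr_row_mul]) fun y => ?_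
    have h4 : (∑ l, f l) * (x - f' i * x) = 0 := by
      rw [mul_sub, ← mul_assoc _ (f' i), H.unit_mul_row, h]
    have h5 : (x - f' i * x) * (∑ l, f l) = x - f' i * x := by rw [sub_mul, mul_assoc, h2]
    rw [← h5, ← H.isUnit.mul_mul', ← mul_assoc _ (x - f' i * x), h4]
    simp
  rw [sub_eq_zero.1 h3, ← mul_assoc, H.unit_mul_row, sub_self]

omit hG in
theorem phiMap_col_mul {j : Fin m} {w : A} (hw : w ∈ J10col 𝒜 f' f j) :
    phiMap G f' f w * f j = 0 := by
  obtain ⟨x, h1, h2, rfl⟩ := (H.mem_J10col hc).1 hw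
  rw [H.phiMap_col h1 h2, sub_mul, mul_assoc, mul_assoc, H.unit_mul_col, H.idem_col, sub_self]

omit hG in
theorem mul_phiMap_row {i : Fin n} {v : A} (hv : v ∈ J01row 𝒜 f i) :
    f' i * phiMap G f' f v = 0 := by
  obtain ⟨x, h1, h2, rfl⟩ := (H.mem_J01row hc).1 hv
  rw [H.phiMap_row h1 h2, mul_sub, ← mul_assoc, ← mul_assoc, H.row_mul_unit, H.idem_row, sub_self]

/-- The products `v w` and `φ(v) φ(w)` satisfy the same linear relations. -/
theorem sum_mul_eq_zero_iff {i : Fin n} {j : Fin m} {s : ℕ} (v w : Fin s → A)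
    (hv : ∀ l, v l ∈ J01row 𝒜 f i) (hw : ∀ l, w l ∈ J10col 𝒜 f' f j) :
    ∑ l, v l * w l = 0 ↔ ∑ l, phiMap G f' f (v l) * phiMap G f' f (w l) = 0 := by
  choose x hx1 hx2 hx3 using fun l => (H.mem_J01row hc).1 (hv l)
  choose y hy1 hy2 hy3 using fun l => (H.mem_J10col hc).1 (hw l)
  set e := ∑ l, f l with he
  set a := ∑ l, x l * y l with ha
  have ha1 : G.pr i a = a := by
    rw [ha, map_sum]; exact Finset.sum_congr rfl fun l _ => G.pr_mul_of (hx1 l) _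
  have ha2 : G.pc j a = a := by
    rw [ha, map_sum]; exact Finset.sum_congr rfl fun l _ => G.pc_mul_of (hy1 l) _
  -- Both sums depend only on a = ∑ x_l y_l in A_ij: one is (1-e)a(1-e), the other (e-f'_i)a(e-f_j).
  -- Each vanishes exactly when (1-f'_i)a(1-f_j) does.
  have h1 : ∑ l, v l * w l = a - e * a - a * e + e * (a * e) := by
    simp only [ha, Finset.mul_sum, Finset.sum_mul, ← Finset.sum_sub_distrib,
      ← Finset.sum_add_distrib]
    refine Finset.sum_congr rfl fun l _ => ?_
    rw [hx3, hy3]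
    noncomm_ring
  have h2 : ∑ l, phiMap G f' f (v l) * phiMap G f' f (w l)
      = e * (a * e) - f' i * (a * e) - e * (a * f j) + f' i * (a * f j) := by
    simp only [ha, Finset.mul_sum, Finset.sum_mul, ← Finset.sum_sub_distrib,
      ← Finset.sum_add_distrib]
    refine Finset.sum_congr rfl fun l _ => ?_
    rw [hx3, hy3, H.phiMap_row (hx1 l) (hx2 l), H.phiMap_col (hy1 l) (hy2 l)]
    noncomm_ring
  have hee : ∀ z, e * (e * z) = e * z := H.unit_mul_unit_mul
  have hef : ∀ z, e * (f' i * z) = f' i * z := fun z => by rw [← mul_assoc, H.unit_mul_row]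
  have hfe : f j * e = f j := H.col_mul_unit j
  have hee' : e * e = e := H.isUnit.idem
  rw [h1, h2]
  constructor
  · intro h
    have h3 : a = e * a + a * e - e * (a * e) := by
      rw [← sub_eq_zero, ← h]; abel
    -- The projection to A_ij turns the outer factors e into f'_i and f_j.
    have h4 : a = f' i * a + a * f j - f' i * (a * f j) := by
      have := congrArg (fun z => G.pr i (G.pc j z)) h3
      simp only [map_add, map_sub, G.pc_mul, G.pr_mul, he, H.pc_unit, H.pr_unit, ha1, ha2] at this
      exact this
    have h5 : e * (a * e) = f' i * (a * e) + e * (a * f j) - f' i * (a * f j) := by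
      conv_lhs => rw [h4]
      simp only [mul_add, mul_sub, add_mul, sub_mul, mul_assoc, hef, hfe]
    rw [h5]; abel
  · intro h
    -- This element (1-f'_i)a(1-f_j) is homogeneous and in the radical, because multiplying it by e
    -- on both sides gives (e-f'_i)a(e-f_j) = 0.
    have h3 : a - f' i * a - a * f j + f' i * (a * f j) = 0 := by
      refine hG.eq_zero_of_homogeneous (i := i) (j := j) ?_ ?_ fun x y => ?_
      · simp only [map_add, map_sub, ha1, H.pr_row_mul, G.pr_mul_of ha1]
      · simp only [map_add, map_sub, ha2, H.pc_mul_col, G.pc_mul_of ha2,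
          G.pc_mul_of (H.pc_mul_col j a)]
      · have h4 : x * (a - f' i * a - a * f j + f' i * (a * f j)) * y =
            x * (e * (a * e) - f' i * (a * e) - e * (a * f j) + f' i * (a * f j)) * y := by
          simp only [mul_add, mul_sub, add_mul, sub_mul, mul_assoc]
          simp only [he, H.isUnit.mul_mul, H.isUnit.mul_mul']
        rw [h4, h]; simp
    have h5 : a - e * a - a * e + e * (a * e) =
        (a - f' i * a - a * f j + f' i * (a * f j))
        - e * (a - f' i * a - a * f j + f' i * (a * f j))
        - (a - f' i * a - a * f j + f' i * (a * f j)) * e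
        + e * ((a - f' i * a - a * f j + f' i * (a * f j)) * e) := by
      simp only [mul_add, mul_sub, add_mul, sub_mul, mul_assoc, hef, hfe]
      abel
    rw [h5, h3]; simp

end RectIdempotents

end PhiMap

/-! ### The decomposition of A_ij and the dimension bounds -/

section Components

variable {F : Type v} [Field F] {A : Type u} [NonUnitalRing A] [Module F A] {n m : ℕ}
variable [IsScalarTower F A A] [SMulCommClass F A A]
variable {G : RectGrading F A n m} {f' : Fin n → A} {f : Fin m → A}
variable {P : Fin m → Fin n → WithZero Unit} {𝒜 : ReesMatrixSemigroup P → Submodule F A}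

namespace RectIdempotents

variable (H : RectIdempotents G f' f) (hc : G.IsCompatible 𝒜) (hG : G.IsSimple)
include H hc

/-- For v = x(1-e) + (1-e)y the e-terms cancel and φ(v) + v = x(1-f_j) + (1-f'_i)y. The graph is
thus f'_iA_ij(1-f_j) + (1-f'_i)A_ijf_j. -/
theorem mem_phiGraph {i : Fin n} {j : Fin m} {z : A} :
    z ∈ phiGraph (H.phi 𝒜) (J10 𝒜 f' f i j ⊔ J01 𝒜 f i j) ↔
      G.pr i z = z ∧ G.pc j z = z ∧ z = f' i * z + z * f j ∧ f' i * (z * f j) = 0 := by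
  constructor
  · rintro ⟨u, hu, rfl⟩
    obtain ⟨w, hw, v, hv, hwv⟩ := Submodule.mem_sup.1 hu
    obtain ⟨x, hx1, hx2, rfl⟩ := (H.mem_J10 hc).1 hw
    obtain ⟨y, hy1, hy2, rfl⟩ := (H.mem_J01 hc).1 hv
    have h1 : phiMap G f' f u + u = (x - x * f j) + (y - f' i * y) := by
      change _ = (u : A) at hwv
      rw [← hwv, map_add, H.phiMap_col hx1 (H.eq_sandwich hx2),
        H.phiMap_row hy1 (H.eq_sandwich' hy2)]
      abel
    change G.pr i (phiMap G f' f u + u) = phiMap G f' f u + u ∧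
      G.pc j (phiMap G f' f u + u) = phiMap G f' f u + u ∧
      phiMap G f' f u + u = f' i * (phiMap G f' f u + u) + (phiMap G f' f u + u) * f j ∧
      f' i * ((phiMap G f' f u + u) * f j) = 0
    rw [h1]
    have hx3 : G.pr i x = x := by rw [← hx2]; exact H.pr_row_mul i x
    have hy3 : G.pc j y = y := by rw [← hy2]; exact H.pc_mul_col j y
    have h2 : f' i * (f' i * y) = f' i * y := by rw [← mul_assoc, H.idem_row]
    have h3 : f' i * (x * f j) = x * f j := by rw [← mul_assoc, hx2]
    refine ⟨?_, ?_, ?_, ?_⟩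
    · simp only [map_add, map_sub, hx3, hy1, G.pr_mul_of hx3, H.pr_row_mul]
    · simp only [map_add, map_sub, hx1, hy3, H.pc_mul_col, G.pc_mul_of hy3]
    · simp only [mul_add, mul_sub, add_mul, sub_mul, mul_assoc, H.idem_col, hx2, hy2, h2, h3]
      abel
    · simp only [mul_add, mul_sub, add_mul, sub_mul, mul_assoc, H.idem_col, hy2, h2, h3]
      abel
  · rintro ⟨h1, h2, h3, h4⟩
    have hx1 : G.pc j (f' i * z) = f' i * z := G.pc_mul_of h2 _
    have hx2 : f' i * (f' i * z) = f' i * z := by rw [← mul_assoc, H.idem_row]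
    have hy1 : G.pr i (z * f j) = z * f j := G.pr_mul_of h1 _
    have hy2 : z * f j * f j = z * f j := by rw [mul_assoc, H.idem_col]
    refine ⟨⟨_, add_mem (H.col_mem_phiDomain hc hx1 (H.eq_sandwich hx2))
      (H.row_mem_phiDomain hc hy1 (H.eq_sandwich' hy2))⟩, ?_, ?_⟩
    · exact Submodule.add_mem_sup ((H.mem_J10 hc).2 ⟨_, hx1, hx2, rfl⟩)
        ((H.mem_J01 hc).2 ⟨_, hy1, hy2, rfl⟩)
    · change phiMap G f' f (_ + _) + (_ + _) = z
      rw [map_add, H.phiMap_col hx1 (H.eq_sandwich hx2),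
        H.phiMap_row hy1 (H.eq_sandwich' hy2), mul_assoc (f' i) z (f j), h4]
      conv_rhs => rw [h3]
      abel

omit hc in
theorem phi_mul_expand (v w : phiDomain 𝒜 f' f) :
    (H.phi 𝒜 v : A) * (H.phi 𝒜 w : A) + (v : A) * (H.phi 𝒜 w : A) + (H.phi 𝒜 v : A) * (w : A)
      + (v : A) * (w : A) = (phiMap G f' f v + v) * (phiMap G f' f w + w) := by
  simp only [H.phi_apply, mul_add, add_mul]
  abel

include hG

/-- Each generator factors as (φ(v)+v)(φ(w)+w) = (1-f'_i)xy(1-f_j), and A = A³ shows that these span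
(1-f'_i)A_ij(1-f_j). -/
theorem mem_phiSpan {i : Fin n} {j : Fin m} {z : A} :
    z ∈ phiSpan (H.phi 𝒜) i j ↔
      G.pr i z = z ∧ G.pc j z = z ∧ f' i * z = 0 ∧ z * f j = 0 := by
  constructor
  · intro hz
    induction hz using Submodule.span_induction with
    | mem z h =>
      obtain ⟨v, w, hv, hw, rfl⟩ := h
      rw [H.phi_mul_expand]
      obtain ⟨x, hx1, hx2, hx3⟩ := (H.mem_J01row hc).1 hv
      obtain ⟨y, hy1, hy2, hy3⟩ := (H.mem_J10col hc).1 hw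
      have h1 : phiMap G f' f v + v = x - f' i * x := by
        rw [hx3, H.phiMap_row hx1 hx2]; abel
      have h2 : phiMap G f' f w + w = y - y * f j := by
        rw [hy3, H.phiMap_col hy1 hy2]; abel
      rw [h1, h2]
      refine ⟨G.pr_mul_of ?_ _, G.pc_mul_of ?_ _, ?_, ?_⟩
      · rw [map_sub, hx1, H.pr_row_mul]
      · rw [map_sub, hy1, H.pc_mul_col]
      · rw [← mul_assoc, mul_sub (f' i), ← mul_assoc (f' i), H.idem_row, sub_self, zero_mul]
      · rw [mul_assoc, sub_mul y, mul_assoc y, H.idem_col, sub_self, mul_zero]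
    | zero => simp
    | add x y _ _ hx hy =>
      exact ⟨by rw [map_add, hx.1, hy.1], by rw [map_add, hx.2.1, hy.2.1],
        by rw [mul_add, hx.2.2.1, hy.2.2.1, add_zero],
        by rw [add_mul, hx.2.2.2, hy.2.2.2, add_zero]⟩
    | smul c x _ hx =>
      exact ⟨by rw [map_smul, hx.1], by rw [map_smul, hx.2.1],
        by rw [mul_smul_comm, hx.2.2.1, smul_zero],
        by rw [smul_mul_assoc, hx.2.2.2, smul_zero]⟩
  · rintro ⟨h1, h2, h3, h4⟩
    have key : ∀ a : A, G.pr i (G.pc j a) - f' i * G.pr i (G.pc j a) - G.pr i (G.pc j a) * f j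
        + f' i * (G.pr i (G.pc j a) * f j) ∈ phiSpan (H.phi 𝒜) i j := by
      intro a
      induction a using hG.triple_induction with
      | zero => simp
      | add a b ha hb =>
        refine Eq.mp (congrArg (· ∈ _) ?_) (add_mem ha hb)
        simp only [map_add, mul_add, add_mul]; abel
      | smul c a ha =>
        refine Eq.mp (congrArg (· ∈ _) ?_) (Submodule.smul_mem _ c ha)
        simp only [map_smul, smul_sub, smul_add, mul_smul_comm, smul_mul_assoc]
      | mul_mul x a y =>
        have hx1 : G.pr i (G.pr i x * ∑ l, f l) = G.pr i x * ∑ l, f l :=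
          G.pr_mul_of (G.pr_self i x) _
        have hx2 := H.mul_unit_mul_unit (G.pr i x)
        have hy1 : G.pc j ((∑ l, f l) * (a * G.pc j y)) = (∑ l, f l) * (a * G.pc j y) :=
          G.pc_mul_of (G.pc_mul_of (G.pc_self j y) _) _
        have hy2 := H.unit_mul_unit_mul (a * G.pc j y)
        refine Submodule.subset_span ⟨⟨_, H.row_mem_phiDomain hc hx1 hx2⟩,
          ⟨_, H.col_mem_phiDomain hc hy1 hy2⟩, (H.mem_J01row hc).2 ⟨_, hx1, hx2, rfl⟩,
          (H.mem_J10col hc).2 ⟨_, hy1, hy2, rfl⟩, ?_⟩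
        rw [H.phi_mul_expand]
        change _ = (phiMap G f' f (_ - _) + (_ - _)) * (phiMap G f' f (_ - _) + (_ - _))
        rw [H.phiMap_row hx1 hx2, H.phiMap_col hy1 hy2, G.pc_mul, G.pc_mul, G.pr_mul]
        rw [sub_add_sub_cancel', sub_add_sub_cancel']
        simp only [sub_mul, mul_sub, mul_assoc, H.isUnit.mul_mul']
        abel
    have := key z
    rw [h2, h1, h3, h4] at this
    simpa using this

theorem isDirectSum_homComp (i : Fin n) (j : Fin m) : IsDirectSum
    ![(unitSubalgebra F (∑ l, f l)).toSubmodule.map (sandwichMul F (f' i) (f j)),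
      phiGraph (H.phi 𝒜) (J10 𝒜 f' f i j ⊔ J01 𝒜 f i j),
      phiSpan (H.phi 𝒜) i j] (homComp 𝒜 i j) := by
  have hff : ∀ z, f' i * (f' i * z) = f' i * z := fun z => by rw [← mul_assoc, H.idem_row]
  have hS : ∀ b, b ∈ (unitSubalgebra F (∑ l, f l)).toSubmodule.map (sandwichMul F (f' i) (f j)) ↔
      f' i * (b * f j) = b := by
    intro b
    constructor
    · rintro ⟨x, -, rfl⟩
      change f' i * (f' i * x * f j * f j) = f' i * x * f j
      rw [mul_assoc, H.idem_col, mul_assoc, hff]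
    · intro h
      refine ⟨b, ?_, ?_⟩
      · rw [← h, ← mul_assoc]; exact H.sandwich_mem i j b
      · change f' i * b * f j = b
        rw [mul_assoc, h]
  constructor
  · refine iSupIndep_of_sum_eq_zero _ fun x hx h0 => ?_
    rw [Fin.sum_univ_three] at h0
    have h1 := (hS _).1 (hx 0)
    obtain ⟨-, -, h2, h3⟩ := (H.mem_phiGraph hc).1 (hx 1)
    obtain ⟨-, -, h4, h5⟩ := (H.mem_phiSpan hc hG).1 (hx 2)
    have e0 : x 0 = 0 := by
      have := congrArg (fun z => f' i * (z * f j)) h0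
      simpa only [add_mul, mul_add, h1, h3, h5, add_zero, mul_zero, zero_mul] using this
    rw [e0, zero_add] at h0
    have e1 : x 1 = 0 := by
      have a1 := congrArg (fun z => f' i * z) h0
      have a2 := congrArg (fun z => z * f j) h0
      simp only [mul_add, add_mul, h4, h5, add_zero, mul_zero, zero_mul] at a1 a2
      rw [h2, a1, a2, add_zero]
    rw [e1, zero_add] at h0
    rw [Fin.forall_fin_succ, Fin.forall_fin_two]
    exact ⟨e0, e1, h0⟩
  · apply le_antisymm
    · refine iSup_le ?_
      rw [Fin.forall_fin_succ, Fin.forall_fin_two]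
      refine ⟨fun b hb => ?_, fun b hb => ?_, fun b hb => ?_⟩
      · refine (hc.mem_homComp i j b).2 ?_
        rw [← (hS b).1 hb]
        exact ⟨H.pr_row_mul _ _, G.pc_mul_of (H.pc_mul_col _ _) _⟩
      · obtain ⟨h1, h2, -⟩ := (H.mem_phiGraph hc).1 hb
        exact (hc.mem_homComp i j b).2 ⟨h1, h2⟩
      · obtain ⟨h1, h2, -⟩ := (H.mem_phiSpan hc hG).1 hb
        exact (hc.mem_homComp i j b).2 ⟨h1, h2⟩
    · intro a ha
      obtain ⟨h1, h2⟩ := (hc.mem_homComp i j a).1 ha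
      -- The Peirce decomposition for f'_i on the left and f_j on the right, with its two mixed
      -- terms grouped together.
      have e : a = f' i * (a * f j) + ((f' i * a + a * f j - f' i * (a * f j) - f' i * (a * f j)) +
          (a - f' i * a - a * f j + f' i * (a * f j))) := by abel
      rw [e]
      refine add_mem (Submodule.mem_iSup_of_mem 0 ((hS _).2 ?_))
        (add_mem (Submodule.mem_iSup_of_mem 1 ((H.mem_phiGraph hc).2 ⟨?_, ?_, ?_, ?_⟩))
          (Submodule.mem_iSup_of_mem 2 ((H.mem_phiSpan hc hG).2 ⟨?_, ?_, ?_, ?_⟩)))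
      · rw [mul_assoc (f' i), mul_assoc a, H.idem_col, hff]
      · simp only [map_add, map_sub, H.pr_row_mul, G.pr_mul_of h1]
      · simp only [map_add, map_sub, H.pc_mul_col, G.pc_mul_of h2, G.pc_mul_of (H.pc_mul_col j a)]
      · simp only [mul_add, mul_sub, add_mul, sub_mul, mul_assoc, hff, H.idem_col]; abel
      · simp only [mul_add, mul_sub, add_mul, sub_mul, mul_assoc, hff, H.idem_col]; abel
      · simp only [map_add, map_sub, H.pr_row_mul, G.pr_mul_of h1, h1]
      · simp only [map_add, map_sub, H.pc_mul_col, G.pc_mul_of h2, G.pc_mul_of (H.pc_mul_col j a),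
          h2]
      · simp only [mul_add, mul_sub, hff]; abel
      · simp only [add_mul, sub_mul, mul_assoc, H.idem_col]; abel

-- Here Ay = 0, since xy = xye = x(ey)e = 0, and y lies in a single row ideal. This is the
-- injectivity behind the bound for (1-e)Ae.
omit hc in
theorem eq_zero_of_unit_row {i : Fin n} {y : A} (h1 : G.pr i y = y) (h2 : y * ∑ l, f l = y)
    (h3 : (∑ l, f l) * y = 0) : y = 0 := by
  refine hG.eq_zero_of_row h1 fun x => ?_
  rw [← h2, ← H.isUnit.mul_mul', ← mul_assoc _ y, h3]; simp

omit hc in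
theorem eq_zero_of_unit_col {j : Fin m} {y : A} (h1 : G.pc j y = y) (h2 : (∑ l, f l) * y = y)
    (h3 : y * (∑ l, f l) = 0) : y = 0 := by
  refine hG.eq_zero_of_col h1 fun x => ?_
  rw [← h2, mul_assoc, ← H.isUnit.mul_mul, ← mul_assoc y, h3]; simp

variable [FiniteDimensional F A]

/-- The sum of the J⁰¹_{i*} and B meet in 0 inside Ae, and u ↦ (e pr_i(u))_i embeds Ae into Bⁿ.
Keeping dim B on the left avoids a truncated subtraction when n = 0. -/
theorem finrank_J01_add_le :
    Module.finrank F ↥(⨆ i, J01row 𝒜 f i) + Module.finrank F (unitSubalgebra F (∑ l, f l))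
      ≤ n * Module.finrank F (unitSubalgebra F (∑ l, f l)) := by
  set B := (unitSubalgebra F (∑ l, f l)).toSubmodule with hB
  change _ + Module.finrank F B ≤ n * Module.finrank F B
  let U : Submodule F A := LinearMap.eqLocus (LinearMap.mulRight F (∑ l, f l)) LinearMap.id
  have hU : ∀ u, u ∈ U ↔ u * (∑ l, f l) = u := fun u => Iff.rfl
  let Θ : U →ₗ[F] (Fin n → B) :=
    { toFun := fun u i => ⟨(∑ l, f l) * G.pr i (u * ∑ l, f l), by
        rw [G.pr_mul]; exact sandwich_mem_unitSubalgebra (F := F) H.isUnit.idem _⟩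
      map_add' := fun u v => by
        ext i
        change (∑ l, f l) * G.pr i ((u + v) * ∑ l, f l) = _ * G.pr i (u * _) + _ * G.pr i (v * _)
        rw [add_mul, map_add, mul_add]
      map_smul' := fun c u => by
        ext i
        change (∑ l, f l) * G.pr i ((c • u) * ∑ l, f l) = c • (_ * G.pr i (u * _))
        rw [smul_mul_assoc, map_smul, mul_smul_comm] }
  have hΘ : Function.Injective Θ := by
    rw [injective_iff_map_eq_zero]
    intro u hu
    have hu2 := (hU u).1 u.2
    refine Subtype.ext (G.ext_pr fun i => ?_)
    have h1 : (∑ l, f l) * G.pr i (u * ∑ l, f l) = 0 := congrArg Subtype.val (congrFun hu i)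
    rw [hu2] at h1
    rw [ZeroMemClass.coe_zero, map_zero]
    exact H.eq_zero_of_unit_row hG (G.pr_self i u) (by rw [← G.pr_mul, hu2]) h1
  have h1 := LinearMap.finrank_le_finrank_of_injective hΘ
  rw [Module.finrank_pi_fintype, Finset.sum_const, Finset.card_univ, Fintype.card_fin,
    smul_eq_mul] at h1
  refine le_trans ?_ h1
  have hinf : (⨆ i, J01row 𝒜 f i) ⊓ B = ⊥ := by
    rw [eq_bot_iff]
    rintro x ⟨hx1, hx2⟩
    rw [Submodule.mem_bot, ← hx2.1]
    exact ((H.mem_iSup_J01row hc).1 hx1).2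
  have h2 := Submodule.finrank_sup_add_finrank_inf_eq (⨆ i, J01row 𝒜 f i) B
  rw [hinf, finrank_bot, add_zero] at h2
  rw [← h2]
  exact Submodule.finrank_mono (sup_le (fun x hx => ((H.mem_iSup_J01row hc).1 hx).1)
    fun x hx => hx.2)

/-- The mirror argument: eA contains the direct sum and embeds into Bᵐ. -/
theorem finrank_J10_add_le :
    Module.finrank F ↥(⨆ j, J10col 𝒜 f' f j) + Module.finrank F (unitSubalgebra F (∑ l, f l))
      ≤ m * Module.finrank F (unitSubalgebra F (∑ l, f l)) := by
  set B := (unitSubalgebra F (∑ l, f l)).toSubmodule with hB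
  change _ + Module.finrank F B ≤ m * Module.finrank F B
  let U : Submodule F A := LinearMap.eqLocus (LinearMap.mulLeft F (∑ l, f l)) LinearMap.id
  have hU : ∀ u, u ∈ U ↔ (∑ l, f l) * u = u := fun u => Iff.rfl
  let Θ : U →ₗ[F] (Fin m → B) :=
    { toFun := fun u j => ⟨G.pc j ((∑ l, f l) * u) * (∑ l, f l), by
        rw [G.pc_mul, mul_assoc]; exact sandwich_mem_unitSubalgebra (F := F) H.isUnit.idem _⟩
      map_add' := fun u v => by
        ext i
        change G.pc i ((∑ l, f l) * (u + v)) * (∑ l, f l) = G.pc i (_ * u) * _ + G.pc i (_ * v) * _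
        rw [mul_add, map_add, add_mul]
      map_smul' := fun c u => by
        ext i
        change G.pc i ((∑ l, f l) * (c • u)) * (∑ l, f l) = c • (G.pc i (_ * u) * _)
        rw [mul_smul_comm, map_smul, smul_mul_assoc] }
  have hΘ : Function.Injective Θ := by
    rw [injective_iff_map_eq_zero]
    intro u hu
    have hu2 := (hU u).1 u.2
    refine Subtype.ext (G.ext_pc fun i => ?_)
    have h1 : G.pc i ((∑ l, f l) * u) * (∑ l, f l) = 0 := congrArg Subtype.val (congrFun hu i)
    rw [hu2] at h1
    rw [ZeroMemClass.coe_zero, map_zero]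
    exact H.eq_zero_of_unit_col hG (G.pc_self i u) (by rw [← G.pc_mul, hu2]) h1
  have h1 := LinearMap.finrank_le_finrank_of_injective hΘ
  rw [Module.finrank_pi_fintype, Finset.sum_const, Finset.card_univ, Fintype.card_fin,
    smul_eq_mul] at h1
  refine le_trans ?_ h1
  have hinf : (⨆ j, J10col 𝒜 f' f j) ⊓ B = ⊥ := by
    rw [eq_bot_iff]
    rintro x ⟨hx1, hx2⟩
    rw [Submodule.mem_bot, ← hx2.2]
    exact ((H.mem_iSup_J10col hc).1 hx1).2
  have h2 := Submodule.finrank_sup_add_finrank_inf_eq (⨆ j, J10col 𝒜 f' f j) B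
  rw [hinf, finrank_bot, add_zero] at h2
  rw [← h2]
  exact Submodule.finrank_mono (sup_le (fun x hx => ((H.mem_iSup_J10col hc).1 hx).1)
    fun x hx => hx.1)

-- The map a ↦ (e a_ij e)_{ij} from A to B^{nm} is injective: an element of its kernel has all
-- components in J(A), hence is zero. Moreover dim A = dim B + dim J(A).
omit hc in
theorem finrank_radical_add_le :
    Module.finrank F (jacobsonRadical F A) + Module.finrank F (unitSubalgebra F (∑ l, f l))
      ≤ n * m * Module.finrank F (unitSubalgebra F (∑ l, f l)) := by
  have hcompl := Submodule.finrank_add_eq_of_isCompl (hG.isCompl_unitSubalgebra H.isUnit)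
  set B := (unitSubalgebra F (∑ l, f l)).toSubmodule with hB
  change _ + Module.finrank F B ≤ n * m * Module.finrank F B
  rw [add_comm, hcompl]
  let Θ : A →ₗ[F] (Fin n × Fin m → B) :=
    { toFun := fun a q => ⟨(∑ l, f l) * (G.pr q.1 (G.pc q.2 a) * (∑ l, f l)),
        sandwich_mem_unitSubalgebra (F := F) H.isUnit.idem _⟩
      map_add' := fun u v => by
        ext q
        change (∑ l, f l) * (G.pr q.1 (G.pc q.2 (u + v)) * (∑ l, f l)) =
          _ * (G.pr q.1 (G.pc q.2 u) * _) + _ * (G.pr q.1 (G.pc q.2 v) * _)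
        rw [map_add, map_add, add_mul, mul_add]
      map_smul' := fun c u => by
        ext q
        change (∑ l, f l) * (G.pr q.1 (G.pc q.2 (c • u)) * (∑ l, f l)) =
          c • (_ * (G.pr q.1 (G.pc q.2 u) * _))
        rw [map_smul, map_smul, smul_mul_assoc, mul_smul_comm] }
  have hΘ : Function.Injective Θ := by
    rw [injective_iff_map_eq_zero]
    intro a ha
    refine hG.eq_zero_of_components fun i j x y => ?_
    have h1 : (∑ l, f l) * (G.pr i (G.pc j a) * (∑ l, f l)) = 0 :=
      congrArg Subtype.val (congrFun ha (i, j))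
    exact hG.mem_jacobsonRadical_iff.1 ((H.mem_radical_iff hG).2 h1) x y
  have h1 := LinearMap.finrank_le_finrank_of_injective hΘ
  rwa [Module.finrank_pi_fintype, Finset.sum_const, Finset.card_univ, Fintype.card_prod,
    Fintype.card_fin, Fintype.card_fin, smul_eq_mul] at h1

end RectIdempotents

end Components

/-! ### The order of the Rees semigroup -/

section Cardinality

variable {n m : ℕ} (P : Fin m → Fin n → WithZero Unit)

theorem ReesMatrixSemigroup.card_ne_zero :
    Nat.card {s : ReesMatrixSemigroup P // s ≠ 0} = n * m := by
  let E : {s : ReesMatrixSemigroup P // s ≠ 0} ≃ Fin n × Fin m :=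
    { toFun := fun s => match s with
        | ⟨.zero, h⟩ => absurd rfl h
        | ⟨.elt _ i j, _⟩ => (i, j)
      invFun := fun q => ⟨.elt 1 q.1 q.2, fun h => by cases h⟩
      left_inv := by
        rintro ⟨_ | ⟨g, i, j⟩, h⟩
        · exact absurd rfl h
        · rfl
      right_inv := fun q => rfl }
  rw [Nat.card_congr E, Nat.card_prod, Nat.card_fin, Nat.card_fin]

theorem ReesMatrixSemigroup.card : Nat.card (ReesMatrixSemigroup P) = n * m + 1 := by
  let E : ReesMatrixSemigroup P ≃ Option (Fin n × Fin m) :=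
    { toFun := fun s => match s with
        | .zero => none
        | .elt _ i j => some (i, j)
      invFun := fun q => match q with
        | none => .zero
        | some q => .elt 1 q.1 q.2
      left_inv := by rintro (_ | ⟨g, i, j⟩) <;> rfl
      right_inv := by rintro (_ | q) <;> rfl }
  rw [Nat.card_congr E, Finite.card_option, Nat.card_prod, Nat.card_fin, Nat.card_fin]

end Cardinality

/-! ### Assembly -/

theorem mainTheorem5 {F : Type v} [Field F] {A : Type u} [NonUnitalRing A] [Module F A]
    [IsScalarTower F A A] [SMulCommClass F A A] [FiniteDimensional F A]
    {n m : ℕ} (P : Fin m → Fin n → WithZero Unit)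
    (𝒜 : ReesMatrixSemigroup P → Submodule F A)
    (h𝒜 : IsSemigroupGrading 𝒜) (hzero : 𝒜 0 = ⊥) (hsimple : IsGradedSimple 𝒜) :
    (∃ (B : NonUnitalSubalgebra F A) (f' : Fin n → A) (f : Fin m → A),
      IsGradedWedderburnMalcev 𝒜 B f' f) ∧
    ∀ (B : NonUnitalSubalgebra F A) (f' : Fin n → A) (f : Fin m → A),
      IsGradedWedderburnMalcev 𝒜 B f' f →
      -- the left `B`-modules `J¹⁰_{*j} = 1_B L_j (1 - 1_B)`
      (∀ j, J10col 𝒜 f' f j =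
          (colIdeal 𝒜 j).map (mulOneSub F (∑ l, f l) ∘ₗ LinearMap.mulLeft F (∑ l, f l)) ∧
        J10col 𝒜 f' f j ≤ jacobsonRadical F A ∧
        (∀ b ∈ B, ∀ w ∈ J10col 𝒜 f' f j, b * w ∈ J10col 𝒜 f' f j) ∧
        IsDirectSum (fun i => J10 𝒜 f' f i j) (J10col 𝒜 f' f j)) ∧
      -- the right `B`-modules `J⁰¹_{i*} = (1 - 1_B) R_i 1_B`
      (∀ i, J01row 𝒜 f i =
          (rowIdeal 𝒜 i).map (oneSubMul F (∑ l, f l) ∘ₗ LinearMap.mulRight F (∑ l, f l)) ∧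
        J01row 𝒜 f i ≤ jacobsonRadical F A ∧
        (∀ b ∈ B, ∀ v ∈ J01row 𝒜 f i, v * b ∈ J01row 𝒜 f i) ∧
        IsDirectSum (fun j => J01 𝒜 f i j) (J01row 𝒜 f i)) ∧
      -- the decompositions of `J(A)` and `J(A)²`
      IsDirectSum
        (Sum.elim (fun i => J01row 𝒜 f i) (Sum.elim (fun j => J10col 𝒜 f' f j)
          (fun _ : Unit => subspaceMul (jacobsonRadical F A) (jacobsonRadical F A))))
        (jacobsonRadical F A) ∧
      IsDirectSum
        (fun p : Fin n × Fin m => subspaceMul (J01row 𝒜 f p.1) (J10col 𝒜 f' f p.2))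
        (subspaceMul (jacobsonRadical F A) (jacobsonRadical F A)) ∧
      -- the map `φ`
      (∃ φ : phiDomain 𝒜 f' f →ₗ[F] B,
        IsPhi φ ∧ (∀ ψ : phiDomain 𝒜 f' f →ₗ[F] B, IsPhi ψ → ψ = φ) ∧
        (∀ b ∈ B, ∀ w : phiDomain 𝒜 f' f, (w : A) ∈ ⨆ j, J10col 𝒜 f' f j →
          ∃ h : b * (w : A) ∈ phiDomain 𝒜 f' f, (φ ⟨b * (w : A), h⟩ : A) = b * (φ w : A)) ∧
        (∀ j, (∀ w : phiDomain 𝒜 f' f, (w : A) ∈ J10col 𝒜 f' f j → φ w = 0 → w = 0) ∧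
          phiImage φ (J10col 𝒜 f' f j) ⊓ B.toSubmodule.map (LinearMap.mulRight F (f j)) = ⊥ ∧
          (phiImage φ (J10col 𝒜 f' f j)).map (LinearMap.mulRight F (f j)) = ⊥) ∧
        (∀ b ∈ B, ∀ v : phiDomain 𝒜 f' f, (v : A) ∈ ⨆ i, J01row 𝒜 f i →
          ∃ h : (v : A) * b ∈ phiDomain 𝒜 f' f, (φ ⟨(v : A) * b, h⟩ : A) = (φ v : A) * b) ∧
        (∀ i, (∀ v : phiDomain 𝒜 f' f, (v : A) ∈ J01row 𝒜 f i → φ v = 0 → v = 0) ∧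
          phiImage φ (J01row 𝒜 f i) ⊓ B.toSubmodule.map (LinearMap.mulLeft F (f' i)) = ⊥ ∧
          (phiImage φ (J01row 𝒜 f i)).map (LinearMap.mulLeft F (f' i)) = ⊥) ∧
        -- the decomposition of `A_{ij}`
        (∀ i j, IsDirectSum
          ![B.toSubmodule.map (sandwichMul F (f' i) (f j)),
            phiGraph φ (J10 𝒜 f' f i j ⊔ J01 𝒜 f i j),
            phiSpan φ i j]
          (homComp 𝒜 i j)) ∧
        (∀ (i : Fin n) (j : Fin m) (s : ℕ) (v w : Fin s → phiDomain 𝒜 f' f),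
          (∀ l, (v l : A) ∈ J01row 𝒜 f i) → (∀ l, (w l : A) ∈ J10col 𝒜 f' f j) →
          (∑ l, (v l : A) * (w l : A) = 0 ↔ ∑ l, (φ (v l) : A) * (φ (w l) : A) = 0))) ∧
      -- `B ≅ M_k(D)`
      (∃ (k : ℕ) (D : Type u) (_ : DivisionRing D) (_ : Algebra F D),
        0 < k ∧ FiniteDimensional F D ∧
        (∃ Ψ : B →ₙₐ[F] Matrix (Fin k) (Fin k) D, Function.Bijective Ψ) ∧
        Module.finrank F B = k ^ 2 * Module.finrank F D) ∧
      -- the bounds on dimensions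
      ((Module.finrank F ↥(⨆ i, J01row 𝒜 f i) : ℤ) ≤ ((n : ℤ) - 1) * Module.finrank F B) ∧
      ((Module.finrank F ↥(⨆ j, J10col 𝒜 f' f j) : ℤ) ≤ ((m : ℤ) - 1) * Module.finrank F B) ∧
      ((Module.finrank F (jacobsonRadical F A) : ℤ)
        ≤ ((n : ℤ) * m - 1) * Module.finrank F B) ∧
      Nat.card {s : ReesMatrixSemigroup P // s ≠ 0} = n * m ∧
      Nat.card (ReesMatrixSemigroup P) = n * m + 1 := by
  obtain ⟨G, hc⟩ := exists_isCompatible 𝒜 h𝒜 hzero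
  have hG := hc.isSimple h𝒜.isDirectSum.1 hsimple
  refine ⟨?_, fun B f' f hB => ?_⟩
  · obtain ⟨f', f, H⟩ := hG.exists_rectIdempotents
    exact ⟨_, f', f, H.isGradedWedderburnMalcev hG hc⟩
  have H := hB.rectIdempotents hG hc
  -- An arbitrary B as in (a) is replaced by the corner eAe with e = ∑ f_j, to which all the
  -- preceding results apply.
  obtain rfl := hB.eq_unitSubalgebra hG
  refine ⟨fun j => ⟨H.J10col_eq hc j, H.J10col_le hG hc j, fun b hb w hw =>
      H.J10col_mul_mem hc hb hw, H.isDirectSum_J10 hc j⟩,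
    fun i => ⟨H.J01row_eq hc i, H.J01row_le hG hc i, fun b hb v hv =>
      H.J01row_mul_mem hc hb hv, H.isDirectSum_J01 hc i⟩,
    H.isDirectSum_radical hG hc, H.isDirectSum_sq_radical hG hc,
    ⟨H.phi 𝒜, H.isPhi_phi hc, fun ψ hψ => H.eq_of_isPhi hc hψ (H.isPhi_phi hc), ?_, ?_, ?_, ?_,
      fun i j => H.isDirectSum_homComp hc hG i j, fun i j s v w hv hw =>
        H.sum_mul_eq_zero_iff hc hG (fun l => (v l : A)) (fun l => (w l : A)) hv hw⟩,
    hG.exists_matrix_equiv H.isUnit, ?_, ?_, ?_, ReesMatrixSemigroup.card_ne_zero P,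
    ReesMatrixSemigroup.card P⟩
  · intro b hb w hw
    have hw' := (H.mem_iSup_J10col hc).1 hw
    refine ⟨Submodule.mem_sup_right ((H.mem_iSup_J10col hc).2 ⟨?_, ?_⟩),
      H.phiMap_mul_left hc hb hw⟩
    · rw [← mul_assoc, hb.1]
    · rw [mul_assoc, hw'.2, mul_zero]
  · intro j
    refine ⟨fun w hw h0 => Subtype.ext (H.eq_zero_of_phiMap_col hc hG hw (congrArg Subtype.val h0)),
      ?_, ?_⟩
    · rw [eq_bot_iff]
      rintro _ ⟨⟨_, ⟨w, hw, rfl⟩, rfl⟩, ⟨b, -, hb⟩⟩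
      rw [Submodule.mem_bot]
      change b * f j = phiMap G f' f w at hb
      change phiMap G f' f w = 0
      have h0 : phiMap G f' f w * f j = 0 := H.phiMap_col_mul hc hw
      -- An element of Bf_j is fixed by right multiplication by f_j, whereas that multiplication
      -- kills φ(w).
      rwa [← hb, mul_assoc, H.idem_col, hb] at h0
    · rw [eq_bot_iff]
      rintro _ ⟨_, ⟨_, ⟨w, hw, rfl⟩, rfl⟩, rfl⟩
      exact H.phiMap_col_mul hc hw
  · intro b hb v hv
    have hv' := (H.mem_iSup_J01row hc).1 hv
    refine ⟨Submodule.mem_sup_left ((H.mem_iSup_J01row hc).2 ⟨?_, ?_⟩),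
      H.phiMap_mul_right hc hb hv⟩
    · rw [mul_assoc, hb.2]
    · rw [← mul_assoc, hv'.2, zero_mul]
  · intro i
    refine ⟨fun v hv h0 => Subtype.ext (H.eq_zero_of_phiMap_row hc hG hv (congrArg Subtype.val h0)),
      ?_, ?_⟩
    · rw [eq_bot_iff]
      rintro _ ⟨⟨_, ⟨v, hv, rfl⟩, rfl⟩, ⟨b, -, hb⟩⟩
      rw [Submodule.mem_bot]
      change f' i * b = phiMap G f' f v at hb
      change phiMap G f' f v = 0
      have h0 : f' i * phiMap G f' f v = 0 := H.mul_phiMap_row hc hv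
      rwa [← hb, ← mul_assoc, H.idem_row, hb] at h0
    · rw [eq_bot_iff]
      rintro _ ⟨_, ⟨_, ⟨v, hv, rfl⟩, rfl⟩, rfl⟩
      exact H.mul_phiMap_row hc hv
  · have h := H.finrank_J01_add_le hc hG
    rw [sub_mul, one_mul, le_sub_iff_add_le]
    exact_mod_cast h
  · have h := H.finrank_J10_add_le hc hG
    rw [sub_mul, one_mul, le_sub_iff_add_le]
    exact_mod_cast h
  · have h := H.finrank_radical_add_le hG
    rw [sub_mul, one_mul, le_sub_iff_add_le]
    exact_mod_cast h
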